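/- **Setting.** A (finite-horizon) Dec-POMDP $D$ consists of agents $\mathcal N=\{1,\dots,N\}$ ($N\ge 1$), a finite set $\mathcal S$ of states, finite non-empty sets $\mathcal A_i$ of actions and finite sets $\mathcal O_i$ of observations ($i\in\mathcal N$; $\mathcal A=\prod_i\mathcal A_i$, $\mathcal O=\prod_i\mathcal O_i$), kernels $P:\mathcal S\times\mathcal A\to\Delta(\mathcal S)$ and $O:\mathcal S\times\mathcal A\to\Delta(\mathcal O)$, a reward function $\mathcal R:\mathcal S\times\mathcal A\to\mathbb R$, an initial distribution $b_0\in\Delta(\mathcal S)$ and a horizon $T\ge 0$. A local policy $\pi_i$ maps every action-observation history in $\bigcup_{t\le T}(\mathcal A_i\times\mathcal O_i)^t$ to a distribution on $\mathcal A_i$; $\Pi^D$ is the set of joint policies $\pi=(\pi_i)_i$. Under $\mathbb P_\pi$: $S_0\sim b_0$, $A_{i,t}\sim\pi_i(\cdot\mid AO_{i,t})$ with $AO_{i,t}=(A_{i,0},O_{i,1},\dots,A_{i,t-1},O_{i,t})$, $R_t=\mathcal R(S_t,A_t)$, $S_{t+1}\sim P(\cdot\mid S_t,A_t)$, $O_{t+1}\sim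 O(\cdot\mid S_{t+1},A_t)$. The history $H=(S_t,A_t,R_t)_{0\le t\le T},(O_t)_{1\le t\le T}$ has values in the finite set $\mathcal H^D$ (rewards ranging over the values of $\mathcal R$), and $J^D(\pi)=\mathbb E_\pi[\sum_{t=0}^T R_t]$. An isomorphism $f\in\mathrm{Iso}(D,E)$ (where $T^D=T^E$) is a tuple of bijections $f_N:\mathcal N^D\to\mathcal N^E$, $f_S:\mathcal S^D\to\mathcal S^E$, $f_{A_i}:\mathcal A_i^D\to\mathcal A^E_{f_N(i)}$, $f_{O_i}:\mathcal O_i^D\to\mathcal O^E_{f_N(i)}$ that preserves $P,O,\mathcal R,b_0$, where $(fa)_{f_N(i)}=f_{A_i}(a_i)$ for joint actions, likewise for joint observations; it acts element-wise on histories and fixes rewards. $\mathrm{Aut}(D)=\mathrm{Iso}(D,D)$, and $(f^*\pi)_{i}(a\mid\tau)=\pi_{f^{-1}i}(f^{-1}a\mid f^{-1}\tau)$. For a profile $\mathbf g\in\mathrm{Aut}(D)^{\mathcal N}$ put $(\mathbf g^*\pi)_i=(\mathbf g_i^*\pi)_i$. The other-play objective is $J^D_{\mathrm{OP}}(\pi)=\mathbb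 E_{\mathbf g\sim\mathcal U(\mathrm{Aut}(D)^{\mathcal N})}[J^D(\mathbf g^*\pi)]$, and $\Pi^D_{\mathrm{OP}}=\arg\max J^D_{\mathrm{OP}}$. Let $\mu_i$ be the law of $(\mathbf g^*\pi)_i$ for $\mathbf g\sim\mathcal U(\mathrm{Aut}(D)^{\mathcal N})$. The symmetrizer $\Psi^D:\Pi^D\to\Pi^D$ is given by $$\Psi^D(\pi)_i(a\mid\tau)=\mathbb P_{\mu_i\otimes\mu_{-i}}(A_{i,t}=a\mid AO_{i,t}=\tau),$$ where $\mu_{-i}$ is any distribution of the other agents' policies with independent local policies such that $AO_{i,t}=\tau$ has positive probability when the policies are drawn from $\mu_i\otimes\mu_{-i}$ and then followed (if there is none, the value is $1/|\mathcal A_i|$). Write $\pi\equiv\pi'$ if $\Psi^D(\pi)=\Psi^D(\pi')$, $[\pi]$ for the class of $\pi$, and $f^*[\pi]=[f^*\pi]$. A labeling $f\in\mathrm{Sym}(D)$ is a tuple of bijections $f_N:\mathcal N\to\mathcal N$, $f_S:\mathcal S\to\{0,\dots,|\mathcal S|-1\}$, $f_{A_i}:\mathcal A_i\to\{0,\dots,|\mathcal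 A_i|-1\}$, $f_{O_i}:\mathcal O_i\to\{0,\dots,|\mathcal O_i|-1\}$; $f^*D$ is the Dec-POMDP on these label sets (agent $j$ having those of $f_N^{-1}j$) to which $f$ transports the data of $D$, so that $f\in\mathrm{Iso}(D,f^*D)$. The normal form $\iota(\tau)$ of $\tau\in\mathcal H^D$ numbers the states, and for each agent its actions and its observations, by $0,1,2,\dots$ in the order of first occurrence in $\tau$. $\mathcal K(\tau)\subseteq\mathrm{Sym}(D)$ is the set of labelings $f$ such that $f\tau$ is in normal form, i.e. $f\tau=f_N(\iota(\tau))$, where $f_N$ permutes the agents. Let $\mathcal D$ be a set of Dec-POMDPs and let $\#(L,\tau)$, for $L=f^*D$, $D\in\mathcal D$, $f\in\mathrm{Sym}(D)$, $\tau\in\mathcal H^{L}$, be i.i.d. real random variables on a probability space $(\Omega_\#,\mathbb P_\#)$ with $\mathbb P_\#(\#(L,\tau)=\lambda)=0$ for all $\lambda\in\mathbb R$. Define $$\chi^\#(D,\pi)=\mathbb E_{\tau\sim\mathbb P_{\Psi^D(\pi)}(H\in\cdot)}\Big[\mathbb E_{f\sim\mathcal U(\mathcal K(\tau))}\big[\#(f^*D,f\tau)\big]\Big]\qquad(D\in\mathcal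 D,\ \pi\in\Pi^D).$$ A real function $\chi$ of pairs $(D,\pi)$ is a *tie-breaking function* for a set $\mathcal C$ of Dec-POMDPs if for every $D\in\mathcal C$ it attains a maximum on $\{(D,\pi):\pi\in\Pi^D_{\mathrm{OP}}\}$, and $\chi(D,\pi)=\chi(D,\pi')$ implies $\pi\equiv\pi'$ for all $\pi,\pi'\in\Pi^D_{\mathrm{OP}}$. It is *invariant to isomorphism* on $\mathcal C$ if $\chi(D,\pi)=\chi(E,\pi')$ whenever $D,E\in\mathcal C$, $f\in\mathrm{Iso}(D,E)$, $\pi\in\Pi^D$, $\pi'\in\Pi^E$ and $f^*[\pi]=[\pi']$. **Theorem.** 1. For every realization $\omega\in\Omega_\#$, $\chi^\#$ is invariant to isomorphism on $\mathcal D$; and if all hash values at $\omega$ lie in $[0,1]$, then so do all values of $\chi^\#$. 2. Assume that for every $D\in\mathcal D$ and $\pi,\pi'\in\Pi^D$, if $\mathbb P_{\Psi^D(\pi)}(H=\tau)=\mathbb P_{\Psi^D(\pi')}(H=\tau)$ for all $\tau\in\mathcal H^D$, then $\Psi^D(\pi)=\Psi^D(\pi')$. Then for every $D\in\mathcal D$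 and all $\pi,\pi'\in\Pi^D$ with $\pi\not\equiv\pi'$, $\mathbb P_\#$-almost surely $\chi^\#(D,\pi)\ne\chi^\#(D,\pi')$. 3. Assume in addition that $\Pi^D_{\mathrm{OP}}/{\equiv}$ is finite for every $D\in\mathcal D$. Then for every countable $\mathcal C\subseteq\mathcal D$ (in particular for $\mathcal C=\mathcal D$ if $\mathcal D$ is countable), $\chi^\#$ is $\mathbb P_\#$-almost surely a tie-breaking function for $\mathcal C$. -/

import Mathlib

noncomputable section

namespace LFC

open MeasureTheory ProbabilityTheory
open scoped ENNReal BigOperators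

/-- The finite sets underlying a Dec-POMDP: agents `{0, …, N - 1}`, states, and for every agent its
individual actions and observations. -/
structure Frame where
  N : ℕ
  N_pos : 0 < N
  S : Type
  A : Fin N → Type
  Ob : Fin N → Type
  finS : Finite S
  finA : ∀ i, Finite (A i)
  finOb : ∀ i, Finite (Ob i)
  neA : ∀ i, Nonempty (A i)

attribute [instance] Frame.finS Frame.finA Frame.finOb Frame.neA

/-- Joint actions. -/
abbrev Frame.JointA (X : Frame) : Type := ∀ i, X.A i

/-- Joint observations. -/
abbrev Frame.JointO (X : Frame) : Type := ∀ i, X.Ob i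

/-- A finite-horizon Dec-POMDP. -/
structure DecPOMDP extends Frame where
  /-- transition kernel -/
  P : S → toFrame.JointA → PMF S
  /-- reward function -/
  R : S → toFrame.JointA → ℝ
  /-- observation kernel -/
  O : S → toFrame.JointA → PMF toFrame.JointO
  /-- initial state distribution -/
  b₀ : PMF S
  /-- horizon -/
  T : ℕ

/-- A tuple of bijections `(f_N, f_S, (f_{A_i})_i, (f_{O_i})_i)` with `f_{A_i} : A_i → A'_{f_N i}` and
`f_{O_i} : O_i → O'_{f_N i}`. The bijection of agent `i` is stored under the index `j = f_N i`, that is,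
`A j` is `f_{A_{f_N⁻¹ j}}` and `Ob j` is `f_{O_{f_N⁻¹ j}}`. -/
structure Bij (X Y : Frame) where
  N : Fin X.N ≃ Fin Y.N
  S : X.S ≃ Y.S
  A : ∀ j, X.A (N.symm j) ≃ Y.A j
  Ob : ∀ j, X.Ob (N.symm j) ≃ Y.Ob j

namespace Bij

variable {X Y : Frame}

/-- Action on joint actions: `(f a)_j = f_{A_{f_N⁻¹ j}} (a_{f_N⁻¹ j})`. -/
def onA (f : Bij X Y) : X.JointA ≃ Y.JointA :=
  (Equiv.piCongrLeft' X.A f.N).trans (Equiv.piCongrRight f.A)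

/-- Action on joint observations: `(f o)_j = f_{O_{f_N⁻¹ j}} (o_{f_N⁻¹ j})`. -/
def onO (f : Bij X Y) : X.JointO ≃ Y.JointO :=
  (Equiv.piCongrLeft' X.Ob f.N).trans (Equiv.piCongrRight f.Ob)

instance : Finite (Bij X Y) := by
  let φ : Bij X Y → Σ n : Fin X.N ≃ Fin Y.N,
      (X.S ≃ Y.S) × (∀ j, X.A (n.symm j) ≃ Y.A j) × (∀ j, X.Ob (n.symm j) ≃ Y.Ob j) :=
    fun f => ⟨f.N, f.S, f.A, f.Ob⟩
  refine Finite.of_injective φ ?_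
  rintro ⟨n, s, a, o⟩ ⟨n', s', a', o'⟩ h
  simp only [φ, Sigma.mk.injEq] at h
  obtain ⟨rfl, h⟩ := h
  simpa using h

end Bij

/-- Dec-POMDP isomorphisms, the set `Iso(D, E)`. -/
structure Iso (D E : DecPOMDP) extends Bij D.toFrame E.toFrame where
  horizon : D.T = E.T
  trans : ∀ s a s', D.P s a s' = E.P (S s) (toBij.onA a) (S s')
  obser : ∀ s a o, D.O s a o = E.O (S s) (toBij.onA a) (toBij.onO o)
  reward : ∀ s a, D.R s a = E.R (S s) (toBij.onA a)
  init : ∀ s, D.b₀ s = E.b₀ (S s)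

namespace Iso

variable {D E : DecPOMDP}

lemma toBij_injective : Function.Injective (Iso.toBij (D := D) (E := E)) := by
  rintro ⟨f, _⟩ ⟨g, _⟩ h
  cases h
  rfl

instance : Finite (Iso D E) := Finite.of_injective _ toBij_injective

instance : Fintype (Iso D E) := Fintype.ofFinite _

/-- The identity automorphism. -/
def refl (D : DecPOMDP) : Iso D D where
  N := Equiv.refl _
  S := Equiv.refl _
  A _ := Equiv.refl _
  Ob _ := Equiv.refl _
  horizon := rfl
  trans _ _ _ := rfl
  obser _ _ _ := rfl
  reward _ _ := rfl
  init _ := rfl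

end Iso

/-- Automorphisms. -/
abbrev Aut (D : DecPOMDP) : Type := Iso D D

instance (D : DecPOMDP) : Nonempty (Aut D) := ⟨Iso.refl D⟩

/-! ### Histories, policies and the induced process -/

/-- Histories of length `t`: states, joint actions and rewards at the times `0, …, t` and joint
observations at the times `1, …, t` (`obs s` is the observation at time `s + 1`). -/
structure History (D : DecPOMDP) (t : ℕ) where
  state : Fin (t + 1) → D.S
  act : Fin (t + 1) → D.JointA
  rew : Fin (t + 1) → Set.range (fun p : D.S × D.JointA => D.R p.1 p.2)
  obs : Fin t → D.JointO

/-- Complete histories, `ℋ^D`. -/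
abbrev Episode (D : DecPOMDP) : Type := History D D.T

namespace History

variable {D E : DecPOMDP} {t : ℕ}

instance : Finite (History D t) := by
  let φ : History D t → (Fin (t + 1) → D.S) × (Fin (t + 1) → D.JointA) ×
      (Fin (t + 1) → Set.range (fun p : D.S × D.JointA => D.R p.1 p.2)) × (Fin t → D.JointO) :=
    fun h => (h.state, h.act, h.rew, h.obs)
  refine Finite.of_injective φ ?_
  rintro ⟨s, a, r, o⟩ ⟨s', a', r', o'⟩ h
  simpa [φ] using h

instance : Fintype (History D t) := Fintype.ofFinite _

/-- The action-observation history `(a_{i,0}, o_{i,1}, …, a_{i,s-1}, o_{i,s})` of agent `i` at time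
`s ≤ t`. -/
def ao (h : History D t) (i : Fin D.N) (s : ℕ) (hs : s ≤ t) : Fin s → D.A i × D.Ob i :=
  fun r => (h.act ⟨r, by omega⟩ i, h.obs ⟨r, by omega⟩ i)

/-- The element-wise action of an isomorphism on histories; rewards are left unchanged. -/
def map (f : Iso D E) (h : History D t) : History E t where
  state s := f.S (h.state s)
  act s := f.onA (h.act s)
  rew s := ⟨(h.rew s : ℝ), by
    obtain ⟨p, hp⟩ := (h.rew s).2
    exact ⟨(f.S p.1, f.onA p.2), (f.reward p.1 p.2).symm.trans hp⟩⟩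
  obs s := f.onO (h.obs s)

end History

/-- Local stochastic policies of agent `i`: a distribution over actions for every action-observation
history of length `t ≤ T`. -/
def LocalPolicy (D : DecPOMDP) (i : Fin D.N) : Type :=
  ∀ t : ℕ, t ≤ D.T → (Fin t → D.A i × D.Ob i) → PMF (D.A i)

/-- Joint stochastic policies, `Π^D`. -/
abbrev Policy (D : DecPOMDP) : Type := ∀ i, LocalPolicy D i

/-- The σ-algebra on local policies generated by the probabilities `π_i(a ∣ τ)`. -/
instance (D : DecPOMDP) (i : Fin D.N) : MeasurableSpace (LocalPolicy D i) :=
  ⨆ (t : ℕ) (ht : t ≤ D.T) (τ : Fin t → D.A i × D.Ob i) (a : D.A i),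
    MeasurableSpace.comap (fun p : LocalPolicy D i => p t ht τ a) (borel ℝ≥0∞)

/-- The pushforward `(f^*π)_j(a ∣ τ) = π_{f⁻¹ j}(f⁻¹ a ∣ f⁻¹ τ)` of a policy by an isomorphism. -/
def pushPolicy {D E : DecPOMDP} (f : Iso D E) (π : Policy D) : Policy E :=
  fun j t ht τ =>
    (π (f.N.symm j) t (ht.trans_eq f.horizon.symm)
      (fun s => ((f.A j).symm (τ s).1, (f.Ob j).symm (τ s).2))).map (f.A j)

/-- `g^*π` for a profile `g` of automorphisms: agent `i` follows `proj_i (g_i^*π)`. -/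
def pushProfile {D : DecPOMDP} (g : Fin D.N → Aut D) (π : Policy D) : Policy D :=
  fun i => pushPolicy (g i) π i

open Classical in
/-- `ℙ_π(H_t = h)`, the probability of a history of length `t` when the agents follow `π`. -/
def prob {D : DecPOMDP} (π : Policy D) {t : ℕ} (ht : t ≤ D.T) (h : History D t) : ℝ≥0∞ :=
  D.b₀ (h.state 0) *
  (∏ s : Fin t, D.P (h.state s.castSucc) (h.act s.castSucc) (h.state s.succ) *
    D.O (h.state s.succ) (h.act s.castSucc) (h.obs s)) *
  (∏ s : Fin (t + 1),
    (∏ i, π i s (by omega) (h.ao i s (by omega)) (h.act s i)) *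
    (if (h.rew s : ℝ) = D.R (h.state s) (h.act s) then 1 else 0))

/-- Expected return `J^D(π)`. -/
def selfPlay {D : DecPOMDP} (π : Policy D) : ℝ :=
  ∑ h : Episode D, (prob π le_rfl h).toReal * ∑ s, (h.rew s : ℝ)

/-- The other-play objective: the mean of `J^D(g^*π)` over uniformly random profiles of automorphisms. -/
def otherPlay {D : DecPOMDP} (π : Policy D) : ℝ :=
  Finset.expect Finset.univ (fun g : Fin D.N → Aut D => selfPlay (pushProfile g π))

/-- The set `Π_OP^D` of maximizers of the other-play objective. -/
def opOptimal (D : DecPOMDP) : Set (Policy D) :=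
  {π | ∀ π' : Policy D, otherPlay π' ≤ otherPlay π}

/-! ### Policies corresponding to distributions over policies, and the symmetrizer -/

open Classical in
/-- `ℙ_μ(H_t ∈ Q)` when first a joint policy is drawn from `μ` and then followed. -/
def mixProb {D : DecPOMDP} (μ : Measure (Policy D)) {t : ℕ} (ht : t ≤ D.T)
    (Q : Set (History D t)) : ℝ≥0∞ :=
  ∑ h : History D t, if h ∈ Q then ∫⁻ π, prob π ht h ∂μ else 0

/-- The event `AO_{i,t} = τ`. -/
def aoEvent {D : DecPOMDP} (i : Fin D.N) (t : ℕ) (τ : Fin t → D.A i × D.Ob i) : Set (History D t) :=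
  {h | h.ao i t le_rfl = τ}

/-- The event `A_{i,t} = a`. -/
def actEvent {D : DecPOMDP} (i : Fin D.N) (t : ℕ) (a : D.A i) : Set (History D t) :=
  {h | h.act (Fin.last t) i = a}

/-- The distribution `μ_i ⊗ μ_{-i}` with independent local policies (`ν i` is ignored). -/
def withOpponents {D : DecPOMDP} (i : Fin D.N) (μi : ProbabilityMeasure (LocalPolicy D i))
    (ν : ∀ j, ProbabilityMeasure (LocalPolicy D j)) : Measure (Policy D) :=
  Measure.pi (fun j => (Function.update ν i μi j : Measure (LocalPolicy D j)))

lemma prob_le_one {D : DecPOMDP} (π : Policy D) {t : ℕ} (ht : t ≤ D.T) (h : History D t) :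
    prob π ht h ≤ 1 := by
  unfold prob
  refine mul_le_one' (mul_le_one' (PMF.coe_le_one _ _) (Finset.prod_le_one' fun s _ =>
    mul_le_one' (PMF.coe_le_one _ _) (PMF.coe_le_one _ _))) (Finset.prod_le_one' fun s _ =>
    mul_le_one' (Finset.prod_le_one' fun i _ => PMF.coe_le_one _ _) ?_)
  split_ifs <;> simp

lemma mixProb_ne_top {D : DecPOMDP} (μ : Measure (Policy D)) [IsProbabilityMeasure μ] {t : ℕ}
    (ht : t ≤ D.T) (Q : Set (History D t)) : mixProb μ ht Q ≠ ⊤ := by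
  unfold mixProb
  refine ENNReal.sum_ne_top.2 fun h _ => ?_
  split_ifs
  · refine ne_top_of_le_ne_top ENNReal.one_ne_top ?_
    calc ∫⁻ π, prob π ht h ∂μ ≤ ∫⁻ _, 1 ∂μ := lintegral_mono fun π => prob_le_one π ht h
      _ = 1 := by simp
  · simp

instance {D : DecPOMDP} (i : Fin D.N) (μi : ProbabilityMeasure (LocalPolicy D i))
    (ν : ∀ j, ProbabilityMeasure (LocalPolicy D j)) : IsProbabilityMeasure (withOpponents i μi ν) := by
  unfold withOpponents
  infer_instance

lemma tsum_mixProb {D : DecPOMDP} (μ : Measure (Policy D)) (i : Fin D.N) {t : ℕ} (ht : t ≤ D.T)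
    (τ : Fin t → D.A i × D.Ob i) :
    ∑' a, mixProb μ ht (actEvent i t a ∩ aoEvent i t τ) = mixProb μ ht (aoEvent i t τ) := by
  classical
  let _ := Fintype.ofFinite (D.A i)
  rw [tsum_fintype]
  unfold mixProb
  rw [Finset.sum_comm]
  refine Finset.sum_congr rfl fun h _ => ?_
  by_cases hh : h ∈ aoEvent i t τ
  · rw [Finset.sum_eq_single (h.act (Fin.last t) i)]
    · simp [hh, actEvent]
    · intro b _ hb
      simp [actEvent, hb.symm]
    · simp
  · simp [hh]

/-- `ℙ_μ(A_{i,t} = · ∣ AO_{i,t} = τ)`, if the condition has positive probability. -/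
def condAction {D : DecPOMDP} (μ : Measure (Policy D)) [IsProbabilityMeasure μ] (i : Fin D.N) {t : ℕ}
    (ht : t ≤ D.T) (τ : Fin t → D.A i × D.Ob i) (h : mixProb μ ht (aoEvent i t τ) ≠ 0) :
    PMF (D.A i) :=
  ⟨fun a => mixProb μ ht (actEvent i t a ∩ aoEvent i t τ) / mixProb μ ht (aoEvent i t τ), by
    rw [ENNReal.summable.hasSum_iff]
    simp only [div_eq_mul_inv]
    rw [ENNReal.tsum_mul_right, tsum_mixProb]
    exact ENNReal.mul_inv_cancel h (mixProb_ne_top _ _ _)⟩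

open Classical in
/-- The local policy `π_i^{μ_i}` corresponding to a distribution `μ_i` over local policies of agent `i`:
the conditional distribution of the action given the action-observation history, with the opponents
following any distribution (with independent local policies) under which that history has positive
probability, and uniform if there is none. -/
def mixtureLocal {D : DecPOMDP} (i : Fin D.N) (μi : ProbabilityMeasure (LocalPolicy D i)) :
    LocalPolicy D i :=
  fun t ht τ =>
    if h : ∃ ν : ∀ j, ProbabilityMeasure (LocalPolicy D j),
        mixProb (withOpponents i μi ν) ht (aoEvent i t τ) ≠ 0 then
      condAction (withOpponents i μi h.choose) i ht τ h.choose_spec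
    else
      letI := Fintype.ofFinite (D.A i)
      PMF.uniformOfFintype (D.A i)

/-- The other-play distribution of `π`, i.e. the law of `g^*π` for a uniformly random profile `g` of
automorphisms. -/
def opDist {D : DecPOMDP} (π : Policy D) : PMF (Policy D) :=
  (PMF.uniformOfFintype (Fin D.N → Aut D)).map (fun g => pushProfile g π)

/-- The marginal of the other-play distribution for agent `i`. -/
def opMarginal {D : DecPOMDP} (π : Policy D) (i : Fin D.N) : ProbabilityMeasure (LocalPolicy D i) :=
  ⟨((opDist π).map (fun σ => σ i)).toMeasure, inferInstance⟩

/-- The symmetrizer `Ψ^D`. -/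
def symmetrizer {D : DecPOMDP} (π : Policy D) : Policy D :=
  fun i => mixtureLocal i (opMarginal π i)

/-- The equivalence `π ≡_D π'`, i.e. `Ψ^D(π) = Ψ^D(π')`. -/
def policySetoid (D : DecPOMDP) : Setoid (Policy D) := Setoid.ker symmetrizer

/-! ### Labelings and relabeled Dec-POMDPs -/

/-- Labelings of a Dec-POMDP, the set `Sym(D)`; the labels are `{0, …, k - 1}`. -/
structure Labeling (X : Frame) where
  N : Fin X.N ≃ Fin X.N
  S : X.S ≃ Fin (Nat.card X.S)
  A : ∀ i, X.A i ≃ Fin (Nat.card (X.A i))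
  Ob : ∀ i, X.Ob i ≃ Fin (Nat.card (X.Ob i))

namespace Labeling

instance (X : Frame) : Finite (Labeling X) := by
  let φ : Labeling X → (Fin X.N ≃ Fin X.N) × (X.S ≃ Fin (Nat.card X.S)) ×
      (∀ i, X.A i ≃ Fin (Nat.card (X.A i))) × (∀ i, X.Ob i ≃ Fin (Nat.card (X.Ob i))) :=
    fun f => (f.N, f.S, f.A, f.Ob)
  refine Finite.of_injective φ ?_
  rintro ⟨n, s, a, o⟩ ⟨n', s', a', o'⟩ h
  simpa [φ] using h

instance (X : Frame) : Fintype (Labeling X) := Fintype.ofFinite _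

/-- The sets underlying a relabeled Dec-POMDP. -/
def frame {X : Frame} (f : Labeling X) : Frame where
  N := X.N
  N_pos := X.N_pos
  S := Fin (Nat.card X.S)
  A j := Fin (Nat.card (X.A (f.N.symm j)))
  Ob j := Fin (Nat.card (X.Ob (f.N.symm j)))
  finS := inferInstance
  finA _ := inferInstance
  finOb _ := inferInstance
  neA j := ⟨f.A (f.N.symm j) (Classical.arbitrary _)⟩

/-- A labeling as a tuple of bijections onto the relabeled sets. -/
def toBij {X : Frame} (f : Labeling X) : Bij X f.frame where
  N := f.N
  S := f.S
  A j := f.A (f.N.symm j)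
  Ob j := f.Ob (f.N.symm j)

/-- The relabeled Dec-POMDP `f^*D`. -/
def relabel (D : DecPOMDP) (f : Labeling D.toFrame) : DecPOMDP where
  toFrame := f.frame
  P s a := (D.P (f.toBij.S.symm s) (f.toBij.onA.symm a)).map f.toBij.S
  R s a := D.R (f.toBij.S.symm s) (f.toBij.onA.symm a)
  O s a := (D.O (f.toBij.S.symm s) (f.toBij.onA.symm a)).map f.toBij.onO
  b₀ := D.b₀.map f.toBij.S
  T := D.T

lemma map_equiv_apply {α β : Type} (p : PMF α) (e : α ≃ β) (x : α) : p.map e (e x) = p x := by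
  classical
  rw [PMF.map_apply, tsum_eq_single x]
  · simp
  · intro y hy
    simp [hy.symm]

/-- A labeling is an isomorphism from `D` to `f^*D`. -/
def toIso (D : DecPOMDP) (f : Labeling D.toFrame) : Iso D (relabel D f) where
  toBij := f.toBij
  horizon := rfl
  trans s a s' := by
    change _ = (D.P (f.toBij.S.symm (f.toBij.S s)) (f.toBij.onA.symm (f.toBij.onA a))).map
      f.toBij.S (f.toBij.S s')
    rw [map_equiv_apply, f.toBij.S.symm_apply_apply, f.toBij.onA.symm_apply_apply]
  obser s a o := by
    change _ = (D.O (f.toBij.S.symm (f.toBij.S s)) (f.toBij.onA.symm (f.toBij.onA a))).map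
      f.toBij.onO (f.toBij.onO o)
    rw [map_equiv_apply, f.toBij.S.symm_apply_apply, f.toBij.onA.symm_apply_apply]
  reward s a := by
    change _ = D.R (f.toBij.S.symm (f.toBij.S s)) (f.toBij.onA.symm (f.toBij.onA a))
    rw [f.toBij.S.symm_apply_apply, f.toBij.onA.symm_apply_apply]
  init s := (map_equiv_apply _ f.toBij.S s).symm

/-- The history `f τ` of the relabeled Dec-POMDP. -/
def onEpisode {D : DecPOMDP} (f : Labeling D.toFrame) (τ : Episode D) : Episode (relabel D f) :=
  History.map (f.toIso D) τ

end Labeling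

/-! ### Normal forms, hashes and tie-breaking functions -/

/-- Histories whose states, actions and observations are natural numbers. -/
structure NumHistory (N t : ℕ) where
  state : Fin (t + 1) → ℕ
  act : Fin (t + 1) → Fin N → ℕ
  rew : Fin (t + 1) → ℝ
  obs : Fin t → Fin N → ℕ

/-- The permutation of the agents in a numbered history. -/
def NumHistory.permute {N t : ℕ} (e : Fin N ≃ Fin N) (h : NumHistory N t) : NumHistory N t where
  state := h.state
  act s j := h.act s (e.symm j)
  rew := h.rew
  obs s j := h.obs s (e.symm j)

/-- Numbering by order of first occurrence: the number of `x t` counts the distinct values that occur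
before the first occurrence of `x t` in the sequence `x`. -/
def firstOccurrence {n : ℕ} {α : Type} (x : Fin n → α) (t : Fin n) : ℕ :=
  (x '' {s | ∀ r ≤ s, x r ≠ x t}).ncard

/-- The normal form `ι(τ)`: states, and for each agent its actions and its observations, are numbered
by order of first occurrence. -/
def normalForm {D : DecPOMDP} {t : ℕ} (τ : History D t) : NumHistory D.N t where
  state := firstOccurrence τ.state
  act s i := firstOccurrence (fun r => τ.act r i) s
  rew s := τ.rew s
  obs s i := firstOccurrence (fun r => τ.obs r i) s

/-- The history `f τ` of a relabeled Dec-POMDP with its labels read as natural numbers. -/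
def Labeling.numbers {D : DecPOMDP} (f : Labeling D.toFrame) (τ : Episode D) :
    NumHistory D.N D.T where
  state s := Fin.val (n := Nat.card D.S) ((f.onEpisode τ).state s)
  act s j := Fin.val (n := Nat.card (D.A (f.N.symm j))) ((f.onEpisode τ).act s j)
  rew s := (f.onEpisode τ).rew s
  obs s j := Fin.val (n := Nat.card (D.Ob (f.N.symm j))) ((f.onEpisode τ).obs s j)

open Classical in
/-- The set `𝒦(τ)` of labelings `f` for which `f τ` is the normal form of `τ`; since `f` also permutes the
agents, this normal form is `f_N(ι(τ))`. -/
def normalLabelings {D : DecPOMDP} (τ : Episode D) : Finset (Labeling D.toFrame) :=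
  Finset.univ.filter fun f => f.numbers τ = (normalForm τ).permute f.N

/-- The arguments of hash functions: a Dec-POMDP with one of its histories. -/
abbrev HashArg : Type 1 := Σ L : DecPOMDP, Episode L

/-- The arguments `(f^*D, τ)` with `D ∈ 𝒟`, `f ∈ Sym(D)` and `τ ∈ ℋ^{f^*D}`. -/
def hashArgs (𝒟 : Set DecPOMDP) : Set HashArg :=
  {x | ∃ D ∈ 𝒟, ∃ f : Labeling D.toFrame, x.1 = f.relabel D}

/-- Random hash functions for `𝒟`: the values at the arguments `(f^*D, τ)` are i.i.d. real random
variables without atoms. -/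
structure IsRandomHash (𝒟 : Set DecPOMDP) {Ω : Type*} [MeasurableSpace Ω] (μ : Measure Ω)
    (hash : HashArg → Ω → ℝ) : Prop where
  measurable : ∀ x ∈ hashArgs 𝒟, Measurable (hash x)
  indep : iIndepFun (fun x : hashArgs 𝒟 => hash x) μ
  identDistrib : ∀ x ∈ hashArgs 𝒟, ∀ y ∈ hashArgs 𝒟, IdentDistrib (hash x) (hash y) μ μ
  noAtoms : ∀ x ∈ hashArgs 𝒟, ∀ c : ℝ, μ {ω | hash x ω = c} = 0

/-- `χ^#(D, π)` for a realization `η` of the hash function: the expectation, over the history `τ` under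
`Ψ^D(π)`, of the mean of `η(f^*D, f τ)` over uniformly random `f ∈ 𝒦(τ)`. -/
def chi (η : HashArg → ℝ) (D : DecPOMDP) (π : Policy D) : ℝ :=
  ∑ τ : Episode D, (prob (symmetrizer π) le_rfl τ).toReal *
    Finset.expect (normalLabelings τ) (fun f => η ⟨f.relabel D, f.onEpisode τ⟩)

/-- Tie-breaking functions for `𝒟`: `χ(D, ·)` attains a maximum on the set of OP-optimal policies, and
separates OP-optimal policies that are not equivalent. -/
def IsTieBreaking (𝒟 : Set DecPOMDP) (χ : ∀ D : DecPOMDP, Policy D → ℝ) : Prop :=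
  ∀ D ∈ 𝒟,
    (∃ π ∈ opOptimal D, ∀ π' ∈ opOptimal D, χ D π' ≤ χ D π) ∧
    (∀ π ∈ opOptimal D, ∀ π' ∈ opOptimal D, χ D π = χ D π' → policySetoid D π π')

/-- Invariance to isomorphism: `f^*[π] = [π']` implies `χ(D, π) = χ(E, π')`, where `f^*[π] = [f^*π]`. -/
def IsIsoInvariant (𝒟 : Set DecPOMDP) (χ : ∀ D : DecPOMDP, Policy D → ℝ) : Prop :=
  ∀ D ∈ 𝒟, ∀ E ∈ 𝒟, ∀ (f : Iso D E) (π : Policy D) (π' : Policy E),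
    Quotient.mk (policySetoid E) (pushPolicy f π) = Quotient.mk (policySetoid E) π' →
      χ D π = χ E π'

/-- The set of equivalence classes of OP-optimal policies, `Π_OP^D / ≡`, is finite. -/
def FiniteOPClasses (D : DecPOMDP) : Prop :=
  Finite (Quotient ((policySetoid D).comap ((↑) : opOptimal D → Policy D)))

/-- Symmetrized policies that induce the same distribution over histories are equal. -/
def HistoriesDetermine (D : DecPOMDP) : Prop :=
  ∀ π π' : Policy D,
    (∀ τ : Episode D, prob (symmetrizer π) le_rfl τ = prob (symmetrizer π') le_rfl τ) →
      symmetrizer π = symmetrizer π'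

end LFC

end

/-!
An isomorphism carries automorphism profiles to automorphism profiles and action-observation
histories to action-observation histories, so symmetrization commutes with the pushforward of
policies. It also maps `𝒦(τ)` bijectively onto `𝒦(f τ)` without changing the relabeled Dec-POMDP or
the relabeled history, so the hash values averaged by `χ^#` at `D` and at `E` are the same.

For two policies `π`, `π'` the difference `χ^#(D, π) - χ^#(D, π')` is a linear combination of hash
values. Two pairs `(τ, f)` whose hash arguments `(f^*D, f τ)` coincide differ by an automorphism of
`D`, which preserves both the probabilities of histories under symmetrized policies and `|𝒦(τ)|`.
Coefficients with the same argument are therefore equal and do not cancel. If `π ≢ π'`, some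
coefficient is non-zero, and a non-trivial combination of independent atomless variables is almost
surely non-zero. With finitely many classes of optimal policies and countably many Dec-POMDPs, this
holds almost surely for all pairs at once.
-/

noncomputable section

namespace LFC

open MeasureTheory ProbabilityTheory
open scoped ENNReal

namespace Bij

variable {X Y Z : Frame}

/-- Composition `g ∘ f` of tuples of bijections. -/
def comp (f : Bij X Y) (g : Bij Y Z) : Bij X Z where
  N := f.N.trans g.N
  S := f.S.trans g.S
  A j := (f.A (g.N.symm j)).trans (g.A j)
  Ob j := (f.Ob (g.N.symm j)).trans (g.Ob j)

/-- The inverse tuple of bijections. Since `f.A` is indexed by the agents of `Y`, the inverse of its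
entry at `f.N i` has to be transported along `f.N.symm (f.N i) = i`. -/
def inv (f : Bij X Y) : Bij Y X where
  N := f.N.symm
  S := f.S.symm
  A i := (f.A (f.N i)).symm.trans (Equiv.cast (congrArg X.A (f.N.symm_apply_apply i)))
  Ob i := (f.Ob (f.N i)).symm.trans (Equiv.cast (congrArg X.Ob (f.N.symm_apply_apply i)))

lemma onA_inv_onA (f : Bij X Y) (b : Y.JointA) : f.onA (f.inv.onA b) = b := by
  funext j
  have apply_cast_symm : ∀ k (h : k = j),
      f.A j (Equiv.cast (congrArg (X.A <| f.N.symm ·) h) ((f.A k).symm (b k))) = b j := by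
    rintro _ rfl
    exact (f.A _).apply_symm_apply _
  exact apply_cast_symm _ (f.N.apply_symm_apply j)

lemma onO_inv_onO (f : Bij X Y) (o : Y.JointO) : f.onO (f.inv.onO o) = o := by
  funext j
  have apply_cast_symm : ∀ k (h : k = j),
      f.Ob j (Equiv.cast (congrArg (X.Ob <| f.N.symm ·) h) ((f.Ob k).symm (o k))) = o j := by
    rintro _ rfl
    exact (f.Ob _).apply_symm_apply _
  exact apply_cast_symm _ (f.N.apply_symm_apply j)

lemma comp_right_injective (f : Bij X Y) : Function.Injective (fun g : Bij Y Z => f.comp g) := by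
  rintro ⟨n, s, a, o⟩ ⟨n', s', a', o'⟩ h
  injection h with hn hs ha ho
  obtain rfl : n = n' := by simpa [← Equiv.trans_assoc] using congrArg (f.N.symm.trans ·) hn
  obtain rfl : s = s' := by simpa [← Equiv.trans_assoc] using congrArg (f.S.symm.trans ·) hs
  obtain rfl : a = a' := funext fun j => by
    simpa [← Equiv.trans_assoc] using
      congrArg ((f.A _).symm.trans ·) (congrFun (eq_of_heq ha) j)
  obtain rfl : o = o' := funext fun j => by
    simpa [← Equiv.trans_assoc] using
      congrArg ((f.Ob _).symm.trans ·) (congrFun (eq_of_heq ho) j)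
  rfl

lemma comp_left_injective (g : Bij Y Z) : Function.Injective (fun f : Bij X Y => f.comp g) := by
  rintro ⟨n, s, a, o⟩ ⟨n', s', a', o'⟩ h
  injection h with hn hs ha ho
  obtain rfl : n = n' := by simpa [Equiv.trans_assoc] using congrArg (Equiv.trans · g.N.symm) hn
  obtain rfl : s = s' := by simpa [Equiv.trans_assoc] using congrArg (Equiv.trans · g.S.symm) hs
  obtain rfl : a = a' := funext <| g.N.symm.surjective.forall.2 fun k => by
    simpa [Equiv.trans_assoc] using
      congrArg (Equiv.trans · (g.A k).symm) (congrFun (eq_of_heq ha) k)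
  obtain rfl : o = o' := funext <| g.N.symm.surjective.forall.2 fun k => by
    simpa [Equiv.trans_assoc] using
      congrArg (Equiv.trans · (g.Ob k).symm) (congrFun (eq_of_heq ho) k)
  rfl

end Bij

namespace Iso

variable {D E F : DecPOMDP}

/-- Composition `g ∘ f` of isomorphisms. -/
def comp (f : Iso D E) (g : Iso E F) : Iso D F where
  toBij := f.toBij.comp g.toBij
  horizon := f.horizon.trans g.horizon
  trans s a s' := (f.trans s a s').trans (g.trans _ _ _)
  obser s a o := (f.obser s a o).trans (g.obser _ _ _)
  reward s a := (f.reward s a).trans (g.reward _ _)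
  init s := (f.init s).trans (g.init _)

/-- The inverse isomorphism. -/
def inv (f : Iso D E) : Iso E D where
  toBij := f.toBij.inv
  horizon := f.horizon.symm
  trans s a s' := by
    have := f.trans (f.S.symm s) (f.toBij.inv.onA a) (f.S.symm s')
    rw [Equiv.apply_symm_apply, Equiv.apply_symm_apply, Bij.onA_inv_onA] at this
    exact this.symm
  obser s a o := by
    have := f.obser (f.S.symm s) (f.toBij.inv.onA a) (f.toBij.inv.onO o)
    rw [Equiv.apply_symm_apply, Bij.onA_inv_onA, Bij.onO_inv_onO] at this
    exact this.symm
  reward s a := by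
    have := f.reward (f.S.symm s) (f.toBij.inv.onA a)
    rw [Equiv.apply_symm_apply, Bij.onA_inv_onA] at this
    exact this.symm
  init s := by
    have := f.init (f.S.symm s)
    rw [Equiv.apply_symm_apply] at this
    exact this.symm

lemma comp_right_injective (f : Iso D E) : Function.Injective (fun g : Iso E F => f.comp g) :=
  fun _ _ h => toBij_injective (f.toBij.comp_right_injective (congrArg toBij h))

lemma comp_left_injective (g : Iso E F) : Function.Injective (fun f : Iso D E => f.comp g) :=
  fun _ _ h => toBij_injective (g.toBij.comp_left_injective (congrArg toBij h))

lemma comp_right_bijective (f : Iso D E) : Function.Bijective (fun g : Iso E F => f.comp g) :=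
  f.comp_right_injective.bijective_of_nat_card_le
    (Nat.card_le_card_of_injective _ f.inv.comp_right_injective)

lemma comp_left_bijective (g : Iso E F) : Function.Bijective (fun f : Iso D E => f.comp g) :=
  g.comp_left_injective.bijective_of_nat_card_le
    (Nat.card_le_card_of_injective _ g.inv.comp_left_injective)

end Iso

namespace History

variable {D E : DecPOMDP} {t t' : ℕ}

@[ext]
lemma ext {h h' : History D t} (state : ∀ s, h.state s = h'.state s)
    (act : ∀ s, h.act s = h'.act s) (rew : ∀ s, (h.rew s : ℝ) = h'.rew s)
    (obs : ∀ s, h.obs s = h'.obs s) : h = h' := by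
  cases h
  cases h'
  simp only [mk.injEq]
  exact ⟨funext state, funext act, funext fun s => Subtype.ext (rew s), funext obs⟩

/-- The element-wise action of an isomorphism on histories, as a bijection. -/
def mapEquiv (f : Iso D E) : History D t ≃ History E t where
  toFun := map f
  invFun h :=
    { state s := f.S.symm (h.state s)
      act s := f.onA.symm (h.act s)
      rew s := ⟨h.rew s, by
        obtain ⟨⟨x, a⟩, hxa⟩ := (h.rew s).2
        refine ⟨(f.S.symm x, f.onA.symm a), ?_⟩
        simpa only [f.reward, Equiv.apply_symm_apply] using hxa⟩
      obs s := f.onO.symm (h.obs s) }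
  left_inv h := by ext1 s <;> simp [map]
  right_inv h := by ext1 s <;> simp [map]

/-- Transport of histories along an equality of lengths. It is defined componentwise, so that it
commutes definitionally with the other operations on histories. -/
def cast (e : t = t') (h : History D t) : History D t' where
  state s := h.state (s.cast (by rw [e]))
  act s := h.act (s.cast (by rw [e]))
  rew s := h.rew (s.cast (by rw [e]))
  obs s := h.obs (s.cast e.symm)

/-- Transport along an equality of lengths, as a bijection. -/
def castEquiv (e : t = t') : History D t ≃ History D t' where
  toFun := cast e
  invFun := cast e.symm
  left_inv _ := rfl
  right_inv _ := rfl

end History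

namespace Iso

variable {D E : DecPOMDP}

/-- The action `τ ↦ f τ` of an isomorphism on complete histories. -/
def onEpisode (f : Iso D E) (τ : Episode D) : Episode E := (τ.map f).cast f.horizon

/-- The action of an isomorphism on complete histories, as a bijection. -/
def episodeEquiv (f : Iso D E) : Episode D ≃ Episode E :=
  (History.mapEquiv f).trans (History.castEquiv f.horizon)

end Iso

section Symmetrizer

variable {D : DecPOMDP}

/-- The reward of a state and a joint action, as an element of the range of the reward function. -/
def DecPOMDP.rewardInRange (D : DecPOMDP) (x : D.S) (a : D.JointA) :
    Set.range (fun p : D.S × D.JointA => D.R p.1 p.2) :=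
  ⟨D.R x a, (x, a), rfl⟩

open Classical in
/-- The factor of `prob` contributed by the initial distribution, the kernels and the rewards. -/
def envProb {t : ℕ} (h : History D t) : ℝ≥0∞ :=
  D.b₀ (h.state 0) *
  (∏ s : Fin t, D.P (h.state s.castSucc) (h.act s.castSucc) (h.state s.succ) *
    D.O (h.state s.succ) (h.act s.castSucc) (h.obs s)) *
  ∏ s : Fin (t + 1), (if (h.rew s : ℝ) = D.R (h.state s) (h.act s) then 1 else 0)

/-- The factor of `prob` contributed by a local policy `p`: the probability that `p` chooses the
actions of `τ` and then `a`. -/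
def pathWeight {i : Fin D.N} {t : ℕ} (ht : t ≤ D.T) (τ : Fin t → D.A i × D.Ob i) (a : D.A i)
    (p : LocalPolicy D i) : ℝ≥0∞ :=
  (∏ s : Fin t, p s (by omega) (fun r : Fin s => τ ⟨r, by omega⟩) (τ s).1) * p t ht τ a

lemma prob_eq_envProb_mul (π : Policy D) {t : ℕ} (ht : t ≤ D.T) (h : History D t) :
    prob π ht h =
      envProb h * ∏ i, pathWeight ht (h.ao i t le_rfl) (h.act (Fin.last t) i) (π i) := by
  have prod_policies :
      (∏ s : Fin (t + 1), ∏ i, π i s (by omega) (h.ao i s (by omega)) (h.act s i)) =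
        ∏ i, pathWeight ht (h.ao i t le_rfl) (h.act (Fin.last t) i) (π i) :=
    Finset.prod_comm.trans (Finset.prod_congr rfl fun i _ => Fin.prod_univ_castSucc _)
  rw [← prod_policies, envProb, mul_assoc (_ * _)]
  exact congrArg _ (Finset.prod_mul_distrib.trans (mul_comm _ _))

lemma measurable_localPolicy_apply {i : Fin D.N} {t : ℕ} (ht : t ≤ D.T)
    (τ : Fin t → D.A i × D.Ob i) (a : D.A i) :
    Measurable (fun p : LocalPolicy D i => p t ht τ a) :=
  measurable_iff_comap_le.2 <|
    (MeasurableSpace.comap_mono (BorelSpace.measurable_eq (α := ℝ≥0∞)).le).trans <|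
      le_iSup_of_le t <| le_iSup_of_le ht <| le_iSup_of_le τ <| le_iSup_of_le a le_rfl

lemma measurable_pathWeight {i : Fin D.N} {t : ℕ} (ht : t ≤ D.T) (τ : Fin t → D.A i × D.Ob i)
    (a : D.A i) : Measurable (pathWeight ht τ a) :=
  (Finset.measurable_prod _ fun _ _ => measurable_localPolicy_apply _ _ _).mul
    (measurable_localPolicy_apply _ _ _)

lemma lintegral_pi_prod {ι : Type*} [Fintype ι] {X : ι → Type*} [∀ i, MeasurableSpace (X i)]
    (μ : ∀ i, Measure (X i)) [∀ i, IsProbabilityMeasure (μ i)] {w : ∀ i, X i → ℝ≥0∞}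
    (hw : ∀ i, Measurable (w i)) :
    ∫⁻ x, ∏ i, w i (x i) ∂(Measure.pi μ) = ∏ i, ∫⁻ y, w i y ∂(μ i) :=
  calc ∫⁻ x, ∏ i, w i (x i) ∂(Measure.pi μ)
      = ∏ i, ∫⁻ x, w i (x i) ∂(Measure.pi μ) :=
        lintegral_prod_eq_prod_lintegral_of_indepFun Finset.univ _
          (iIndepFun_pi fun i => (hw i).aemeasurable) fun i => (hw i).comp (measurable_pi_apply i)
    _ = ∏ i, ∫⁻ y, w i y ∂(μ i) :=
        Finset.prod_congr rfl fun i _ => (measurePreserving_eval μ i).lintegral_comp (hw i)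

/-- The mean of `pathWeight` over a random local policy. -/
def meanWeight {i : Fin D.N} (μi : ProbabilityMeasure (LocalPolicy D i)) {t : ℕ} (ht : t ≤ D.T)
    (τ : Fin t → D.A i × D.Ob i) (a : D.A i) : ℝ≥0∞ :=
  ∫⁻ p, pathWeight ht τ a p ∂(μi : Measure (LocalPolicy D i))

/-- The factor in the probability of a history contributed by the environment and by all agents
other than `i`, when these draw their local policies from `ν`. -/
def historyOpponentWeight (i : Fin D.N) (ν : ∀ j, ProbabilityMeasure (LocalPolicy D j)) {t : ℕ}
    (ht : t ≤ D.T) (h : History D t) : ℝ≥0∞ :=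
  envProb h *
    ∏ j ∈ Finset.univ.erase i, meanWeight (ν j) ht (h.ao j t le_rfl) (h.act (Fin.last t) j)

lemma lintegral_prob (i : Fin D.N) (μi : ProbabilityMeasure (LocalPolicy D i))
    (ν : ∀ j, ProbabilityMeasure (LocalPolicy D j)) {t : ℕ} (ht : t ≤ D.T) (h : History D t) :
    ∫⁻ π, prob π ht h ∂(withOpponents i μi ν) =
      meanWeight μi ht (h.ao i t le_rfl) (h.act (Fin.last t) i) *
        historyOpponentWeight i ν ht h := by
  have measurable_prod : Measurable fun π : Policy D =>
      ∏ j, pathWeight ht (h.ao j t le_rfl) (h.act (Fin.last t) j) (π j) :=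
    Finset.measurable_prod _ fun j _ =>
      (measurable_pathWeight ht _ _).comp (measurable_pi_apply j)
  simp only [prob_eq_envProb_mul]
  rw [lintegral_const_mul _ measurable_prod, withOpponents,
    lintegral_pi_prod _ fun j => measurable_pathWeight _ _ _,
    ← Finset.mul_prod_erase _ _ (Finset.mem_univ i), mul_left_comm, Function.update_self,
    historyOpponentWeight]
  refine congrArg₂ _ rfl (congrArg₂ _ rfl (Finset.prod_congr rfl fun j hj => ?_))
  rw [Function.update_of_ne (Finset.ne_of_mem_erase hj), meanWeight]

open Classical in
/-- The contribution of the environment and the opponents to the probability of the event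
`A_{i,t} = a, AO_{i,t} = τ`. -/
def opponentWeight (i : Fin D.N) (ν : ∀ j, ProbabilityMeasure (LocalPolicy D j)) {t : ℕ}
    (ht : t ≤ D.T) (τ : Fin t → D.A i × D.Ob i) (a : D.A i) : ℝ≥0∞ :=
  ∑ h : History D t,
    if h ∈ actEvent i t a ∩ aoEvent i t τ then historyOpponentWeight i ν ht h else 0

lemma mixProb_act_ao (i : Fin D.N) (μi : ProbabilityMeasure (LocalPolicy D i))
    (ν : ∀ j, ProbabilityMeasure (LocalPolicy D j)) {t : ℕ} (ht : t ≤ D.T)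
    (τ : Fin t → D.A i × D.Ob i) (a : D.A i) :
    mixProb (withOpponents i μi ν) ht (actEvent i t a ∩ aoEvent i t τ) =
      meanWeight μi ht τ a * opponentWeight i ν ht τ a := by
  rw [mixProb, opponentWeight, Finset.mul_sum]
  refine Finset.sum_congr rfl fun h _ => ?_
  split_ifs with hh
  · obtain ⟨rfl, rfl⟩ := hh
    exact lintegral_prob i μi ν ht h
  · rw [mul_zero]

namespace History

variable {t : ℕ}

/-- Permute the last joint action of a history by `σ`. The last reward is changed by the
transposition of the rewards prescribed before and after, so that this is a bijection of all
histories which preserves whether the last reward is the prescribed one. -/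
def permuteLastAction (σ : Equiv.Perm D.JointA) (h : History D t) : History D t where
  state := h.state
  act := Function.update h.act (Fin.last t) (σ (h.act (Fin.last t)))
  rew := Function.update h.rew (Fin.last t)
    (Equiv.swap (D.rewardInRange (h.state (Fin.last t)) (h.act (Fin.last t)))
      (D.rewardInRange (h.state (Fin.last t)) (σ (h.act (Fin.last t)))) (h.rew (Fin.last t)))
  obs := h.obs

lemma permuteLastAction_act_castSucc (σ : Equiv.Perm D.JointA) (h : History D t) (s : Fin t) :
    (h.permuteLastAction σ).act s.castSucc = h.act s.castSucc :=
  Function.update_of_ne s.castSucc_ne_last _ _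

lemma permuteLastAction_act_last (σ : Equiv.Perm D.JointA) (h : History D t) :
    (h.permuteLastAction σ).act (Fin.last t) = σ (h.act (Fin.last t)) :=
  Function.update_self _ _ _

lemma permuteLastAction_rew_castSucc (σ : Equiv.Perm D.JointA) (h : History D t) (s : Fin t) :
    (h.permuteLastAction σ).rew s.castSucc = h.rew s.castSucc :=
  Function.update_of_ne s.castSucc_ne_last _ _

lemma permuteLastAction_rew_last (σ : Equiv.Perm D.JointA) (h : History D t) :
    (h.permuteLastAction σ).rew (Fin.last t) =
      Equiv.swap (D.rewardInRange (h.state (Fin.last t)) (h.act (Fin.last t)))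
        (D.rewardInRange (h.state (Fin.last t)) (σ (h.act (Fin.last t)))) (h.rew (Fin.last t)) :=
  Function.update_self _ _ _

lemma permuteLastAction_ao (σ : Equiv.Perm D.JointA) (h : History D t) (j : Fin D.N) :
    (h.permuteLastAction σ).ao j t le_rfl = h.ao j t le_rfl :=
  funext fun s => Prod.ext (congrFun (permuteLastAction_act_castSucc σ h s) j) rfl

lemma permuteLastAction_permuteLastAction {σ ρ : Equiv.Perm D.JointA} (hρ : ∀ a, ρ (σ a) = a)
    (h : History D t) : (h.permuteLastAction σ).permuteLastAction ρ = h := by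
  ext1 s
  case state => rfl
  case act => simp [permuteLastAction, hρ]
  case rew =>
    obtain rfl | hs := eq_or_ne s (Fin.last t)
    · simp [permuteLastAction, hρ, Equiv.swap_comm (D.rewardInRange _ (σ _))]
    · simp [permuteLastAction, hs]
  case obs => rfl

lemma envProb_permuteLastAction (σ : Equiv.Perm D.JointA) (h : History D t) :
    envProb (h.permuteLastAction σ) = envProb h := by
  have last_reward : ((h.permuteLastAction σ).rew (Fin.last t) : ℝ) =
        D.R (h.state (Fin.last t)) (σ (h.act (Fin.last t))) ↔
      (h.rew (Fin.last t) : ℝ) = D.R (h.state (Fin.last t)) (h.act (Fin.last t)) := by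
    change _ = (D.rewardInRange _ _ : ℝ) ↔ _ = (D.rewardInRange _ _ : ℝ)
    rw [← Subtype.ext_iff, ← Subtype.ext_iff, permuteLastAction_rew_last,
      Equiv.swap_apply_eq_iff, Equiv.swap_apply_right]
  simp only [envProb, Fin.prod_univ_castSucc (n := t), permuteLastAction_act_castSucc,
    permuteLastAction_act_last, permuteLastAction_rew_castSucc,
    show (h.permuteLastAction σ).state = h.state from rfl,
    show (h.permuteLastAction σ).obs = h.obs from rfl, last_reward]

/-- `permuteLastAction` as a bijection. -/
def permuteLastActionEquiv (σ : Equiv.Perm D.JointA) : Equiv.Perm (History D t) where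
  toFun := permuteLastAction σ
  invFun := permuteLastAction σ.symm
  left_inv := permuteLastAction_permuteLastAction σ.symm_apply_apply
  right_inv := permuteLastAction_permuteLastAction σ.apply_symm_apply

end History

open Classical in
lemma opponentWeight_eq_opponentWeight (i : Fin D.N)
    (ν : ∀ j, ProbabilityMeasure (LocalPolicy D j)) {t : ℕ} (ht : t ≤ D.T)
    (τ : Fin t → D.A i × D.Ob i) (a b : D.A i) :
    opponentWeight i ν ht τ a = opponentWeight i ν ht τ b := by
  let σ : Equiv.Perm D.JointA :=
    Equiv.piCongrRight (Function.update (fun _ => Equiv.refl _) i (Equiv.swap a b))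
  have swap_self (c : D.JointA) : σ c i = Equiv.swap a b (c i) := by simp [σ]
  have swap_of_ne (c : D.JointA) {j : Fin D.N} (hj : j ≠ i) : σ c j = c j := by simp [σ, hj]
  rw [opponentWeight, opponentWeight, ← Equiv.sum_comp (History.permuteLastActionEquiv σ)]
  refine Finset.sum_congr rfl fun h _ => ?_
  change (if h.permuteLastAction σ ∈ actEvent i t a ∩ aoEvent i t τ then
    historyOpponentWeight i ν ht (h.permuteLastAction σ) else 0) = _
  have weight_eq : historyOpponentWeight i ν ht (h.permuteLastAction σ) =
      historyOpponentWeight i ν ht h := by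
    rw [historyOpponentWeight, h.envProb_permuteLastAction]
    refine congrArg _ (Finset.prod_congr rfl fun j hj => ?_)
    rw [h.permuteLastAction_ao, h.permuteLastAction_act_last,
      swap_of_ne _ (Finset.ne_of_mem_erase hj)]
  have mem_iff : h.permuteLastAction σ ∈ actEvent i t a ∩ aoEvent i t τ ↔
      h ∈ actEvent i t b ∩ aoEvent i t τ := by
    simp only [actEvent, aoEvent, Set.mem_inter_iff, Set.mem_ofPred_eq, h.permuteLastAction_ao,
      h.permuteLastAction_act_last, swap_self, Equiv.swap_apply_eq_iff, Equiv.swap_apply_left]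
  simp only [weight_eq, mem_iff]

/-- The mean probability that a random local policy chooses the actions of the action-observation
history `τ`, summed over the next action. -/
def totalWeight {i : Fin D.N} (μi : ProbabilityMeasure (LocalPolicy D i)) {t : ℕ} (ht : t ≤ D.T)
    (τ : Fin t → D.A i × D.Ob i) : ℝ≥0∞ :=
  ∑' a, meanWeight μi ht τ a

lemma mixProb_ao (i : Fin D.N) (μi : ProbabilityMeasure (LocalPolicy D i))
    (ν : ∀ j, ProbabilityMeasure (LocalPolicy D j)) {t : ℕ} (ht : t ≤ D.T)
    (τ : Fin t → D.A i × D.Ob i) (a : D.A i) :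
    mixProb (withOpponents i μi ν) ht (aoEvent i t τ) =
      totalWeight μi ht τ * opponentWeight i ν ht τ a := by
  rw [← tsum_mixProb, totalWeight, ← ENNReal.tsum_mul_right]
  refine tsum_congr fun b => ?_
  rw [mixProb_act_ao, opponentWeight_eq_opponentWeight i ν ht τ b a]

/-- Some history with positive environment probability has the given action-observation history
of agent `i`. -/
def Reachable (i : Fin D.N) {t : ℕ} (τ : Fin t → D.A i × D.Ob i) : Prop :=
  ∃ h : History D t, h.ao i t le_rfl = τ ∧ envProb h ≠ 0

/-- The local policy that always acts uniformly at random; opponents who follow it make every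
reachable action-observation history of an agent possible. -/
def uniformLocal (D : DecPOMDP) (i : Fin D.N) : LocalPolicy D i := fun _ _ _ =>
  letI := Fintype.ofFinite (D.A i)
  PMF.uniformOfFintype (D.A i)

lemma pathWeight_uniformLocal_ne_zero {i : Fin D.N} {t : ℕ} (ht : t ≤ D.T)
    (τ : Fin t → D.A i × D.Ob i) (a : D.A i) : pathWeight ht τ a (uniformLocal D i) ≠ 0 := by
  simp [pathWeight, uniformLocal]

lemma meanWeight_dirac_uniformLocal_ne_zero {i : Fin D.N} {t : ℕ} (ht : t ≤ D.T)
    (τ : Fin t → D.A i × D.Ob i) (a : D.A i) :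
    meanWeight ⟨Measure.dirac (uniformLocal D i), inferInstance⟩ ht τ a ≠ 0 := by
  change ∫⁻ p, pathWeight ht τ a p ∂(Measure.dirac (uniformLocal D i)) ≠ 0
  rw [lintegral_dirac' _ (measurable_pathWeight ht τ a)]
  exact pathWeight_uniformLocal_ne_zero ht τ a

lemma reachable_of_opponentWeight_ne_zero {i : Fin D.N}
    {ν : ∀ j, ProbabilityMeasure (LocalPolicy D j)} {t : ℕ} {ht : t ≤ D.T}
    {τ : Fin t → D.A i × D.Ob i} {a : D.A i} (hw : opponentWeight i ν ht τ a ≠ 0) :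
    Reachable i τ := by
  obtain ⟨h, -, hh⟩ := Finset.exists_ne_zero_of_sum_ne_zero hw
  split_ifs at hh with hmem
  · exact ⟨h, hmem.2, left_ne_zero_of_mul hh⟩
  · exact absurd rfl hh

lemma Reachable.exists_opponentWeight_ne_zero {i : Fin D.N} {t : ℕ} {τ : Fin t → D.A i × D.Ob i}
    (hτ : Reachable i τ) (ht : t ≤ D.T) :
    ∃ (ν : ∀ j, ProbabilityMeasure (LocalPolicy D j)) (a : D.A i),
      opponentWeight i ν ht τ a ≠ 0 := by
  obtain ⟨h, hτ, henv⟩ := hτ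
  refine ⟨fun j => ⟨Measure.dirac (uniformLocal D j), inferInstance⟩, h.act (Fin.last t) i,
    fun hzero => ?_⟩
  have hterm := Finset.sum_eq_zero_iff.1 hzero h (Finset.mem_univ h)
  rw [if_pos ⟨rfl, hτ⟩] at hterm
  exact mul_ne_zero henv (Finset.prod_ne_zero_iff.2 fun j _ =>
    meanWeight_dirac_uniformLocal_ne_zero ht _ _) hterm

lemma exists_opponents_iff (i : Fin D.N) (μi : ProbabilityMeasure (LocalPolicy D i)) {t : ℕ}
    (ht : t ≤ D.T) (τ : Fin t → D.A i × D.Ob i) :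
    (∃ ν : ∀ j, ProbabilityMeasure (LocalPolicy D j),
      mixProb (withOpponents i μi ν) ht (aoEvent i t τ) ≠ 0) ↔
      Reachable i τ ∧ totalWeight μi ht τ ≠ 0 := by
  constructor
  · rintro ⟨ν, hν⟩
    rw [mixProb_ao i μi ν ht τ (Classical.arbitrary _)] at hν
    exact ⟨reachable_of_opponentWeight_ne_zero (right_ne_zero_of_mul hν), left_ne_zero_of_mul hν⟩
  · rintro ⟨hτ, hw⟩
    obtain ⟨ν, a, hν⟩ := hτ.exists_opponentWeight_ne_zero ht
    exact ⟨ν, by rw [mixProb_ao i μi ν ht τ a]; exact mul_ne_zero hw hν⟩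

lemma condAction_apply (i : Fin D.N) (μi : ProbabilityMeasure (LocalPolicy D i))
    (ν : ∀ j, ProbabilityMeasure (LocalPolicy D j)) {t : ℕ} (ht : t ≤ D.T)
    (τ : Fin t → D.A i × D.Ob i) (h : mixProb (withOpponents i μi ν) ht (aoEvent i t τ) ≠ 0)
    (a : D.A i) :
    condAction (withOpponents i μi ν) i ht τ h a =
      meanWeight μi ht τ a / totalWeight μi ht τ := by
  have htop := mixProb_ne_top (withOpponents i μi ν) ht (aoEvent i t τ)
  change mixProb _ ht _ / mixProb _ ht _ = _
  rw [mixProb_ao i μi ν ht τ a] at h htop ⊢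
  rw [mixProb_act_ao]
  exact ENNReal.mul_div_mul_right _ _ (right_ne_zero_of_mul h) fun h' =>
    htop (h' ▸ ENNReal.mul_top (left_ne_zero_of_mul h))

open Classical in
lemma mixtureLocal_apply (i : Fin D.N) (μi : ProbabilityMeasure (LocalPolicy D i)) {t : ℕ}
    (ht : t ≤ D.T) (τ : Fin t → D.A i × D.Ob i) (a : D.A i) :
    mixtureLocal i μi t ht τ a =
      if Reachable i τ ∧ totalWeight μi ht τ ≠ 0 then meanWeight μi ht τ a / totalWeight μi ht τ
      else (Nat.card (D.A i) : ℝ≥0∞)⁻¹ := by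
  simp only [mixtureLocal, ← exists_opponents_iff]
  split_ifs with h
  · exact condAction_apply i μi _ ht τ h.choose_spec a
  · let _ := Fintype.ofFinite (D.A i)
    rw [Nat.card_eq_fintype_card]
    exact PMF.uniformOfFintype_apply a

end Symmetrizer

section Isomorphisms

/-- The bijection `(a, o) ↦ (f_{A_i} a, f_{O_i} o)` of action-observation pairs, where
`j = f_N i`. -/
def Bij.onAO {X Y : Frame} (f : Bij X Y) (j : Fin Y.N) :
    X.A (f.N.symm j) × X.Ob (f.N.symm j) ≃ Y.A j × Y.Ob j :=
  (f.A j).prodCongr (f.Ob j)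

variable {D E F L L' : DecPOMDP}

lemma History.ao_map (f : Iso D E) {t : ℕ} (h : History D t) (j : Fin E.N) (s : ℕ) (hs : s ≤ t) :
    (h.map f).ao j s hs = f.onAO j ∘ h.ao (f.N.symm j) s hs := rfl

/-- The pushforward of a local policy by an isomorphism; `pushPolicy` applies it to every agent. -/
def pushLocal (f : Iso D E) (j : Fin E.N) (p : LocalPolicy D (f.N.symm j)) : LocalPolicy E j :=
  fun t ht τ => (p t (ht.trans_eq f.horizon.symm) ((f.onAO j).symm ∘ τ)).map (f.A j)

lemma pushPolicy_comp (f : Iso D E) (g : Iso E F) (π : Policy D) :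
    pushPolicy (f.comp g) π = pushPolicy g (pushPolicy f π) := by
  funext j t ht τ
  exact (PMF.map_comp (f.A (g.N.symm j)) _ (g.A j)).symm

lemma pushLocal_apply (f : Iso D E) (j : Fin E.N) (p : LocalPolicy D (f.N.symm j)) {t : ℕ}
    (ht : t ≤ D.T) (ht' : t ≤ E.T) (τ : Fin t → D.A (f.N.symm j) × D.Ob (f.N.symm j))
    (a : D.A (f.N.symm j)) :
    pushLocal f j p t ht' (f.onAO j ∘ τ) (f.A j a) = p t ht τ a := by
  rw [pushLocal, Labeling.map_equiv_apply, ← Function.comp_assoc, Equiv.symm_comp_self,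
    Function.id_comp]

lemma measurable_localPolicy {α : Type*} [MeasurableSpace α] {i : Fin D.N}
    {F : α → LocalPolicy D i} (hF : ∀ t ht τ a, Measurable fun x => F x t ht τ a) :
    Measurable F := by
  rw [measurable_iff_comap_le]
  simp only [instMeasurableSpaceLocalPolicy, MeasurableSpace.comap_iSup, iSup_le_iff,
    MeasurableSpace.comap_comp]
  exact fun t ht τ a => measurable_iff_comap_le.1 (hF t ht τ a)

lemma measurable_pushLocal (f : Iso D E) (j : Fin E.N) : Measurable (pushLocal f j) := by
  refine measurable_localPolicy fun t ht τ a => ?_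
  obtain ⟨τ, rfl⟩ := (f.onAO j).surjective.comp_left τ
  obtain ⟨a, rfl⟩ := (f.A j).surjective a
  simp only [pushLocal_apply f j _ (ht.trans_eq f.horizon.symm)]
  exact measurable_localPolicy_apply _ τ a

lemma pathWeight_pushLocal (f : Iso D E) (j : Fin E.N) (p : LocalPolicy D (f.N.symm j)) {t : ℕ}
    (ht : t ≤ D.T) (ht' : t ≤ E.T) (τ : Fin t → D.A (f.N.symm j) × D.Ob (f.N.symm j))
    (a : D.A (f.N.symm j)) :
    pathWeight ht' (f.onAO j ∘ τ) (f.A j a) (pushLocal f j p) = pathWeight ht τ a p :=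
  congrArg₂ _
    (Finset.prod_congr rfl fun (s : Fin t) _ =>
      pushLocal_apply f j p (s.2.le.trans ht) _ (fun r : Fin s => τ ⟨r, r.2.trans s.2⟩) _)
    (pushLocal_apply f j p ht ht' τ a)

lemma envProb_map (f : Iso D E) {t : ℕ} (h : History D t) : envProb (h.map f) = envProb h := by
  refine congrArg₂ _ (congrArg₂ _ (f.init _).symm (Finset.prod_congr rfl fun s _ => ?_))
    (Finset.prod_congr rfl fun s _ => ?_)
  · exact congrArg₂ _ (f.trans _ _ _).symm (f.obser _ _ _).symm
  · rw [f.reward]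
    rfl

lemma prob_map (f : Iso D E) (π : Policy D) {t : ℕ} (ht : t ≤ D.T) (ht' : t ≤ E.T)
    (h : History D t) : prob (pushPolicy f π) ht' (h.map f) = prob π ht h := by
  rw [prob_eq_envProb_mul, prob_eq_envProb_mul, envProb_map, ← Equiv.prod_comp f.N.symm]
  refine congrArg _ (Finset.prod_congr rfl fun j _ => ?_)
  exact pathWeight_pushLocal f j (π (f.N.symm j)) ht ht' (h.ao (f.N.symm j) t le_rfl)
    (h.act (Fin.last t) (f.N.symm j))

lemma prob_cast (π : Policy D) {t t' : ℕ} (e : t = t') (ht : t ≤ D.T) (ht' : t' ≤ D.T)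
    (h : History D t) : prob π ht' (h.cast e) = prob π ht h := by
  subst e
  rfl

lemma prob_onEpisode (f : Iso D E) (π : Policy D) (τ : Episode D) :
    prob (pushPolicy f π) le_rfl (f.onEpisode τ) = prob π le_rfl τ :=
  (prob_cast _ f.horizon f.horizon.le le_rfl _).trans (prob_map f π le_rfl f.horizon.le τ)

lemma reachable_comp_onAO_iff (f : Iso D E) (j : Fin E.N) {t : ℕ}
    (τ : Fin t → D.A (f.N.symm j) × D.Ob (f.N.symm j)) :
    Reachable j (f.onAO j ∘ τ) ↔ Reachable (f.N.symm j) τ := by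
  simp only [Reachable, (History.mapEquiv f).surjective.exists]
  refine exists_congr fun h => ?_
  change (h.map f).ao j t le_rfl = _ ∧ envProb (h.map f) ≠ 0 ↔ _
  rw [History.ao_map, (f.onAO j).injective.comp_left.eq_iff, envProb_map]

lemma meanWeight_map_pushLocal (f : Iso D E) (j : Fin E.N)
    (μ : ProbabilityMeasure (LocalPolicy D (f.N.symm j))) {t : ℕ} (ht : t ≤ D.T) (ht' : t ≤ E.T)
    (τ : Fin t → D.A (f.N.symm j) × D.Ob (f.N.symm j)) (a : D.A (f.N.symm j)) :
    meanWeight (μ.map (measurable_pushLocal f j).aemeasurable) ht' (f.onAO j ∘ τ) (f.A j a) =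
      meanWeight μ ht τ a := by
  rw [meanWeight, ProbabilityMeasure.toMeasure_map,
    lintegral_map (measurable_pathWeight _ _ _) (measurable_pushLocal f j), meanWeight]
  simp only [pathWeight_pushLocal f j _ ht]

lemma mixtureLocal_map_pushLocal (f : Iso D E) (j : Fin E.N)
    (μ : ProbabilityMeasure (LocalPolicy D (f.N.symm j))) :
    mixtureLocal j (μ.map (measurable_pushLocal f j).aemeasurable) =
      pushLocal f j (mixtureLocal (f.N.symm j) μ) := by
  funext t ht' τ
  ext a
  have ht : t ≤ D.T := ht'.trans_eq f.horizon.symm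
  obtain ⟨τ, rfl⟩ := (f.onAO j).surjective.comp_left τ
  obtain ⟨a, rfl⟩ := (f.A j).surjective a
  have totalWeight_eq : totalWeight (μ.map (measurable_pushLocal f j).aemeasurable) ht'
      (f.onAO j ∘ τ) = totalWeight μ ht τ := by
    rw [totalWeight, ← (f.A j).tsum_eq]
    exact tsum_congr (meanWeight_map_pushLocal f j μ ht ht' τ)
  rw [pushLocal_apply f j _ ht, mixtureLocal_apply, mixtureLocal_apply, totalWeight_eq,
    reachable_comp_onAO_iff, meanWeight_map_pushLocal f j μ ht, Nat.card_congr (f.A j)]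

lemma map_uniformOfFintype {α β : Type} [Fintype α] [Nonempty α] [Fintype β] [Nonempty β]
    {e : α → β} (he : e.Bijective) :
    (PMF.uniformOfFintype α).map e = PMF.uniformOfFintype β := by
  ext b
  obtain ⟨a, rfl⟩ := he.surjective b
  have := Labeling.map_equiv_apply (PMF.uniformOfFintype α) (Equiv.ofBijective e he) a
  rw [Equiv.ofBijective_apply] at this
  rw [PMF.uniformOfFintype_apply, ← Fintype.card_of_bijective he, ← PMF.uniformOfFintype_apply a]
  exact this

/-- The law of agent `j`'s part of `h_j^*π` for uniformly random isomorphisms `h_k ∈ Iso(D, E)`. For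
`E = D` this is the other-play distribution; in general it describes the other-play distribution of
every pushforward of `π` to `E` without reference to the isomorphism used. -/
def isoMarginal [Nonempty (Iso D E)] (π : Policy D) (j : Fin E.N) : PMF (LocalPolicy E j) :=
  (PMF.uniformOfFintype (Fin E.N → Iso D E)).map fun h => pushPolicy (h j) π j

lemma opDist_map_eval_eq_isoMarginal (π : Policy D) (i : Fin D.N) :
    (opDist π).map (fun σ => σ i) = isoMarginal π i :=
  PMF.map_comp _ _ _

lemma isoMarginal_pushPolicy [Nonempty (Iso D E)] (f : Iso D E) (π : Policy D) (j : Fin E.N) :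
    isoMarginal (pushPolicy f π) j = isoMarginal π j := by
  simp only [isoMarginal, ← pushPolicy_comp]
  rw [← map_uniformOfFintype f.comp_right_bijective.comp_left, PMF.map_comp]
  rfl

lemma isoMarginal_map_pushLocal [Nonempty (Iso D E)] (f : Iso D E) (π : Policy D) (j : Fin E.N) :
    (isoMarginal π (f.N.symm j)).map (pushLocal f j) = isoMarginal π j := by
  have bijective_comp : Function.Bijective
      fun (g : Fin D.N → Aut D) (k : Fin E.N) => (g (f.N.symm k)).comp f :=
    f.comp_left_bijective.comp_left.comp (Equiv.arrowCongr f.N (Equiv.refl _)).bijective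
  rw [isoMarginal, PMF.map_comp, isoMarginal, ← map_uniformOfFintype bijective_comp, PMF.map_comp]
  congr 1
  funext g
  exact (congrFun (pushPolicy_comp (g (f.N.symm j)) f π) j).symm

lemma coe_opMarginal (π : Policy D) (i : Fin D.N) :
    (opMarginal π i : Measure (LocalPolicy D i)) = (isoMarginal π i).toMeasure := by
  rw [← opDist_map_eval_eq_isoMarginal]
  rfl

lemma opMarginal_pushPolicy_eq (f g : Iso D E) (π : Policy D) :
    opMarginal (pushPolicy f π) = opMarginal (pushPolicy g π) := by
  have : Nonempty (Iso D E) := ⟨f⟩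
  funext j
  apply Subtype.ext
  change (opMarginal (pushPolicy f π) j : Measure (LocalPolicy E j)) = opMarginal (pushPolicy g π) j
  rw [coe_opMarginal, coe_opMarginal, isoMarginal_pushPolicy, isoMarginal_pushPolicy]

lemma opMarginal_pushPolicy (f : Iso D E) (π : Policy D) (j : Fin E.N) :
    opMarginal (pushPolicy f π) j =
      (opMarginal π (f.N.symm j)).map (measurable_pushLocal f j).aemeasurable := by
  have : Nonempty (Iso D E) := ⟨f⟩
  apply Subtype.ext
  change (opMarginal (pushPolicy f π) j : Measure (LocalPolicy E j)) =
    (opMarginal π (f.N.symm j) : Measure (LocalPolicy D (f.N.symm j))).map (pushLocal f j)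
  rw [coe_opMarginal, coe_opMarginal, isoMarginal_pushPolicy, ← isoMarginal_map_pushLocal f,
    PMF.toMeasure_map _ _ (measurable_pushLocal f j)]

lemma symmetrizer_pushPolicy_eq (f g : Iso D E) (π : Policy D) :
    symmetrizer (pushPolicy f π) = symmetrizer (pushPolicy g π) := by
  funext j
  rw [symmetrizer, symmetrizer, opMarginal_pushPolicy_eq f g]

lemma symmetrizer_pushPolicy (f : Iso D E) (π : Policy D) :
    symmetrizer (pushPolicy f π) = pushPolicy f (symmetrizer π) := by
  funext j
  rw [symmetrizer, opMarginal_pushPolicy, mixtureLocal_map_pushLocal]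
  rfl

lemma prob_symmetrizer_onEpisode (f : Iso D E) (π : Policy D) (τ : Episode D) :
    prob (symmetrizer (pushPolicy f π)) le_rfl (f.onEpisode τ) =
      prob (symmetrizer π) le_rfl τ := by
  rw [symmetrizer_pushPolicy, prob_onEpisode]

lemma prob_symmetrizer_eq_of_onEpisode_eq (f : Iso D L) (g : Iso D L') (π : Policy D)
    {τ τ' : Episode D} (h : (⟨L, f.onEpisode τ⟩ : HashArg) = ⟨L', g.onEpisode τ'⟩) :
    prob (symmetrizer π) le_rfl τ = prob (symmetrizer π) le_rfl τ' := by
  obtain ⟨rfl, h⟩ := Sigma.mk.inj h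
  rw [← prob_symmetrizer_onEpisode f, ← prob_symmetrizer_onEpisode g π τ', eq_of_heq h,
    symmetrizer_pushPolicy_eq f g]

end Isomorphisms

section FirstOccurrence

variable {α β : Type} {n : ℕ}

lemma firstOccurrence_comp {φ : α → β} (hφ : φ.Injective) (x : Fin n → α) :
    firstOccurrence (φ ∘ x) = firstOccurrence x := by
  funext t
  unfold firstOccurrence
  rw [← Set.ncard_image_of_injective _ hφ, Set.image_image]
  simp only [Function.comp_apply, hφ.ne_iff]

lemma firstOccurrence_eq_of_eq (x : Fin n → α) {t t' : Fin n} (h : x t = x t') :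
    firstOccurrence x t = firstOccurrence x t' := by
  unfold firstOccurrence
  rw [h]

lemma firstOccurrence_lt [Finite α] (x : Fin n → α) (t : Fin n) :
    firstOccurrence x t < Nat.card α := by
  unfold firstOccurrence
  rw [← Set.ncard_univ]
  refine Set.ncard_lt_ncard (Set.ssubset_univ_iff.2 fun h => ?_) Set.finite_univ
  obtain ⟨s, hs, he⟩ := h.symm ▸ Set.mem_univ (x t)
  exact hs s le_rfl he

lemma firstOccurrence_eq_ncard {x : Fin n → α} {m : Fin n} (hm : ∀ r < m, x r ≠ x m) :
    firstOccurrence x m = (x '' Set.Iio m).ncard := by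
  unfold firstOccurrence
  congr 2
  ext s
  exact ⟨fun hs => not_le.1 fun hms => hs m hms rfl, fun hs r hr => hm r (hr.trans_lt hs)⟩

lemma firstOccurrence_lt_of_lt {x : Fin n → α} {m m' : Fin n} (hm : ∀ r < m, x r ≠ x m)
    (hm' : ∀ r < m', x r ≠ x m') (h : m < m') : firstOccurrence x m < firstOccurrence x m' := by
  rw [firstOccurrence_eq_ncard hm, firstOccurrence_eq_ncard hm']
  refine Set.ncard_lt_ncard ⟨Set.image_mono (Set.Iio_subset_Iio h.le), fun hsub => ?_⟩
    (Set.toFinite _)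
  obtain ⟨r, hr, hrm⟩ := hsub (Set.mem_image_of_mem x h)
  exact hm r hr hrm

lemma exists_first_occurrence (x : Fin n → α) (t : Fin n) :
    ∃ m, x m = x t ∧ ∀ r < m, x r ≠ x m := by
  obtain ⟨m, hm, hmin⟩ := (Set.toFinite {s | x s = x t}).exists_minimal ⟨t, rfl⟩
  exact ⟨m, hm, fun r hr hrm => hr.not_ge (hmin (hrm.trans hm) hr.le)⟩

lemma firstOccurrence_eq_iff (x : Fin n → α) {t t' : Fin n} :
    firstOccurrence x t = firstOccurrence x t' ↔ x t = x t' := by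
  refine ⟨fun h => ?_, firstOccurrence_eq_of_eq x⟩
  obtain ⟨m, hmt, hm⟩ := exists_first_occurrence x t
  obtain ⟨m', hmt', hm'⟩ := exists_first_occurrence x t'
  rw [← firstOccurrence_eq_of_eq x hmt, ← firstOccurrence_eq_of_eq x hmt'] at h
  rcases lt_trichotomy m m' with hlt | rfl | hlt
  · exact absurd h (firstOccurrence_lt_of_lt hm hm' hlt).ne
  · exact hmt.symm.trans hmt'
  · exact absurd h (firstOccurrence_lt_of_lt hm' hm hlt).ne'

lemma exists_equiv_firstOccurrence [Finite α] (x : Fin n → α) :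
    ∃ e : α ≃ Fin (Nat.card α), ∀ t, (e (x t) : ℕ) = firstOccurrence x t := by
  let _ := Fintype.ofFinite α
  let f : α → ℕ := Function.extend x (firstOccurrence x) 0
  have hf : ∀ t, f (x t) = firstOccurrence x t :=
    Function.FactorsThrough.extend_apply (fun _ _ => firstOccurrence_eq_of_eq x) 0
  have mapsTo : Set.MapsTo f (Set.range x) (Finset.range (Nat.card α)) := by
    rintro _ ⟨t, rfl⟩
    exact Finset.mem_coe.2 (Finset.mem_range.2 ((hf t).trans_lt (firstOccurrence_lt x t)))
  have injOn : Set.InjOn f (Set.range x) := by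
    rintro _ ⟨t, rfl⟩ _ ⟨t', rfl⟩ h
    rwa [hf, hf, firstOccurrence_eq_iff] at h
  obtain ⟨e, he⟩ := mapsTo.exists_equiv_extend_of_card_eq
    (by rw [Finset.card_range, Nat.card_eq_fintype_card]) injOn
  refine ⟨e.trans ((Equiv.subtypeEquivRight fun _ => Finset.mem_range).trans
    Fin.equivSubtype.symm), fun t => ?_⟩
  exact (he _ ⟨t, rfl⟩).trans (hf t)

end FirstOccurrence

section NormalForm

variable {D E L L' : DecPOMDP} {t t' : ℕ}

/-- The labels given by `g` number the states, and for each agent its actions and its observations,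
in the order of first occurrence in `h`. -/
structure Labeling.IsNormal (g : Labeling D.toFrame) (h : History D t) : Prop where
  state : ∀ s, (g.S (h.state s) : ℕ) = firstOccurrence h.state s
  act : ∀ i s, (g.A i (h.act s i) : ℕ) = firstOccurrence (fun r => h.act r i) s
  obs : ∀ i s, (g.Ob i (h.obs s i) : ℕ) = firstOccurrence (fun r => h.obs r i) s

lemma mem_normalLabelings {τ : Episode D} {g : Labeling D.toFrame} :
    g ∈ normalLabelings τ ↔ g.IsNormal τ := by
  classical
  refine Finset.mem_filter.trans ⟨fun ⟨_, h⟩ => ?_, fun h => ⟨Finset.mem_univ _, ?_⟩⟩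
  · injection h with state act rew obs
    exact ⟨congrFun state, g.N.symm.surjective.forall.2 fun j s => congrFun (congrFun act s) j,
      g.N.symm.surjective.forall.2 fun j s => congrFun (congrFun obs s) j⟩
  · unfold Labeling.numbers normalForm NumHistory.permute
    rw [NumHistory.mk.injEq]
    exact ⟨funext h.state, funext₂ fun s j => h.act (g.N.symm j) s, rfl,
      funext₂ fun s j => h.obs (g.N.symm j) s⟩

lemma normalLabelings_nonempty (τ : Episode D) : (normalLabelings τ).Nonempty := by
  obtain ⟨s, hs⟩ := exists_equiv_firstOccurrence τ.state
  choose a ha using fun i => exists_equiv_firstOccurrence (fun r => τ.act r i)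
  choose o ho using fun i => exists_equiv_firstOccurrence (fun r => τ.obs r i)
  exact ⟨⟨Equiv.refl _, s, a, o⟩, mem_normalLabelings.2 ⟨hs, ha, ho⟩⟩

lemma Labeling.isNormal_cast (g : Labeling D.toFrame) (h : History D t) (e : t = t') :
    g.IsNormal (h.cast e) ↔ g.IsNormal h := by
  subst e
  rfl

/-- The labeling `g ∘ f⁻¹` of `Y`, for a labeling `g` of `X` and bijections `f` from `X` to `Y`. -/
def Labeling.push {X Y : Frame} (f : Bij X Y) (g : Labeling X) : Labeling Y where
  N := f.N.symm.trans (g.N.trans (finCongr (Fin.equiv_iff_eq.1 ⟨f.N⟩)))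
  S := f.S.symm.trans (g.S.trans (finCongr (Nat.card_congr f.S)))
  A j := (f.A j).symm.trans ((g.A (f.N.symm j)).trans (finCongr (Nat.card_congr (f.A j))))
  Ob j := (f.Ob j).symm.trans ((g.Ob (f.N.symm j)).trans (finCongr (Nat.card_congr (f.Ob j))))

lemma Labeling.push_injective {X Y : Frame} (f : Bij X Y) : Function.Injective (push f) := by
  rintro ⟨n, s, a, o⟩ ⟨n', s', a', o'⟩ h
  injection h with hn hs ha ho
  rw [mk.injEq]
  refine ⟨?_, ?_, funext (f.N.symm.surjective.forall.2 fun j => ?_),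
    funext (f.N.symm.surjective.forall.2 fun j => ?_)⟩
  · ext i
    simpa using congrArg Fin.val (Equiv.congr_fun hn (f.N i))
  · ext x
    simpa using congrArg Fin.val (Equiv.congr_fun hs (f.S x))
  · ext x
    simpa using congrArg Fin.val (Equiv.congr_fun (congrFun ha j) (f.A j x))
  · ext x
    simpa using congrArg Fin.val (Equiv.congr_fun (congrFun ho j) (f.Ob j x))

lemma Labeling.push_bijective {X Y : Frame} (f : Bij X Y) : Function.Bijective (push f) :=
  (push_injective f).bijective_of_nat_card_le
    (Nat.card_le_card_of_injective _ (push_injective f.inv))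

lemma Labeling.push_S_apply {X Y : Frame} (f : Bij X Y) (g : Labeling X) (x : X.S) :
    ((g.push f).S (f.S x) : ℕ) = g.S x :=
  congrArg (fun y => (g.S y : ℕ)) (f.S.symm_apply_apply x)

lemma Labeling.push_A_apply {X Y : Frame} (f : Bij X Y) (g : Labeling X) (j : Fin Y.N)
    (a : X.A (f.N.symm j)) : ((g.push f).A j (f.A j a) : ℕ) = g.A (f.N.symm j) a :=
  congrArg (fun b => (g.A _ b : ℕ)) ((f.A j).symm_apply_apply a)

lemma Labeling.push_Ob_apply {X Y : Frame} (f : Bij X Y) (g : Labeling X) (j : Fin Y.N)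
    (o : X.Ob (f.N.symm j)) : ((g.push f).Ob j (f.Ob j o) : ℕ) = g.Ob (f.N.symm j) o :=
  congrArg (fun b => (g.Ob _ b : ℕ)) ((f.Ob j).symm_apply_apply o)

lemma Labeling.isNormal_push_map (f : Iso D E) (g : Labeling D.toFrame) (h : History D t) :
    (g.push f.toBij).IsNormal (h.map f) ↔ g.IsNormal h := by
  have state_iff : (∀ s, ((g.push f.toBij).S (f.S (h.state s)) : ℕ) =
        firstOccurrence (f.S ∘ h.state) s) ↔
      ∀ s, (g.S (h.state s) : ℕ) = firstOccurrence h.state s := by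
    simp only [push_S_apply, firstOccurrence_comp f.S.injective]
  have act_iff : (∀ j s, ((g.push f.toBij).A j (f.A j (h.act s (f.N.symm j))) : ℕ) =
        firstOccurrence (f.A j ∘ fun r => h.act r (f.N.symm j)) s) ↔
      ∀ i s, (g.A i (h.act s i) : ℕ) = firstOccurrence (fun r => h.act r i) s := by
    simp only [push_A_apply, firstOccurrence_comp (f.A _).injective]
    exact (f.N.symm.surjective.forall (p := fun i =>
      ∀ s, (g.A i (h.act s i) : ℕ) = firstOccurrence (fun r => h.act r i) s)).symm
  have obs_iff : (∀ j s, ((g.push f.toBij).Ob j (f.Ob j (h.obs s (f.N.symm j))) : ℕ) =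
        firstOccurrence (f.Ob j ∘ fun r => h.obs r (f.N.symm j)) s) ↔
      ∀ i s, (g.Ob i (h.obs s i) : ℕ) = firstOccurrence (fun r => h.obs r i) s := by
    simp only [push_Ob_apply, firstOccurrence_comp (f.Ob _).injective]
    exact (f.N.symm.surjective.forall (p := fun i =>
      ∀ s, (g.Ob i (h.obs s i) : ℕ) = firstOccurrence (fun r => h.obs r i) s)).symm
  exact ⟨fun H => ⟨state_iff.1 H.state, act_iff.1 H.act, obs_iff.1 H.obs⟩,
    fun H => ⟨state_iff.2 H.state, act_iff.2 H.act, obs_iff.2 H.obs⟩⟩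

lemma push_mem_normalLabelings (f : Iso D E) {g : Labeling D.toFrame} {τ : Episode D} :
    g.push f.toBij ∈ normalLabelings (f.onEpisode τ) ↔ g ∈ normalLabelings τ := by
  rw [mem_normalLabelings, mem_normalLabelings, ← Labeling.isNormal_push_map f, Iso.onEpisode,
    Labeling.isNormal_cast]

end NormalForm

section Numbered

variable {X Y : Frame}

lemma equivFin_sigma_ext {α : Type*} {m n : ℕ} {e : α ≃ Fin m} {e' : α ≃ Fin n}
    (h : ∀ a, (e a : ℕ) = e' a) : (⟨m, e⟩ : Σ k, α ≃ Fin k) = ⟨n, e'⟩ := by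
  obtain rfl : m = n := Fin.equiv_iff_eq.1 ⟨e.symm.trans e'⟩
  rw [Equiv.ext fun a => Fin.ext (h a)]

/-- The frame on label sets `{0, …, k - 1}` onto which `X` is mapped by given bijections, together
with the tuple of these bijections. The sizes `k` are part of the data, so that two tuples that
assign the same numbers can be compared although the sizes of their label sets, and hence their
types, are only provably equal. -/
def numberedBij (n : Σ k, Fin X.N ≃ Fin k) (s : Σ k, X.S ≃ Fin k)
    (a : ∀ j, Σ k, X.A (n.2.symm j) ≃ Fin k) (o : ∀ j, Σ k, X.Ob (n.2.symm j) ≃ Fin k) :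
    Σ Y : Frame, Bij X Y :=
  ⟨{ N := n.1
     N_pos := (n.2 ⟨0, X.N_pos⟩).pos
     S := Fin s.1
     A j := Fin (a j).1
     Ob j := Fin (o j).1
     finS := inferInstance
     finA _ := inferInstance
     finOb _ := inferInstance
     neA j := ⟨(a j).2 (Classical.arbitrary _)⟩ },
    { N := n.2
      S := s.2
      A j := (a j).2
      Ob j := (o j).2 }⟩

lemma numberedBij_congr {n n' : Σ k, Fin X.N ≃ Fin k} {s s' : Σ k, X.S ≃ Fin k}
    {a : ∀ j, Σ k, X.A (n.2.symm j) ≃ Fin k} {a' : ∀ j, Σ k, X.A (n'.2.symm j) ≃ Fin k}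
    {o : ∀ j, Σ k, X.Ob (n.2.symm j) ≃ Fin k} {o' : ∀ j, Σ k, X.Ob (n'.2.symm j) ≃ Fin k}
    (α : ∀ i, X.A i → ℕ) (ω : ∀ i, X.Ob i → ℕ) (hn : ∀ i, (n.2 i : ℕ) = n'.2 i)
    (hs : ∀ x, (s.2 x : ℕ) = s'.2 x)
    (ha : ∀ j x, ((a j).2 x : ℕ) = α _ x) (ha' : ∀ j x, ((a' j).2 x : ℕ) = α _ x)
    (ho : ∀ j x, ((o j).2 x : ℕ) = ω _ x) (ho' : ∀ j x, ((o' j).2 x : ℕ) = ω _ x) :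
    numberedBij n s a o = numberedBij n' s' a' o' := by
  obtain rfl : n = n' := equivFin_sigma_ext hn
  obtain rfl : s = s' := equivFin_sigma_ext hs
  obtain rfl : a = a' := funext fun j => equivFin_sigma_ext fun x => (ha j x).trans (ha' j x).symm
  obtain rfl : o = o' := funext fun j => equivFin_sigma_ext fun x => (ho j x).trans (ho' j x).symm
  rfl

lemma Labeling.comp_push_toBij (f : Bij X Y) (g : Labeling X) :
    (⟨(g.push f).frame, f.comp (g.push f).toBij⟩ : Σ Z : Frame, Bij X Z) = ⟨g.frame, g.toBij⟩ :=
  numberedBij_congr (n := ⟨Y.N, f.N.trans (g.push f).N⟩) (n' := ⟨X.N, g.N⟩)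
    (s := ⟨_, f.S.trans (g.push f).S⟩) (s' := ⟨_, g.S⟩)
    (a := fun j => ⟨_, (f.A _).trans ((g.push f).A ((g.push f).N.symm j))⟩)
    (a' := fun j => ⟨_, g.A (g.N.symm j)⟩)
    (o := fun j => ⟨_, (f.Ob _).trans ((g.push f).Ob ((g.push f).N.symm j))⟩)
    (o' := fun j => ⟨_, g.Ob (g.N.symm j)⟩)
    (fun i a => g.A i a) (fun i o => g.Ob i o)
    (fun i => congrArg (fun k => (g.N k : ℕ)) (f.N.symm_apply_apply i)) (g.push_S_apply f)
    (fun _ => g.push_A_apply f _) (fun _ _ => rfl) (fun _ => g.push_Ob_apply f _) (fun _ _ => rfl)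

variable {D E L L' : DecPOMDP}

lemma hashArg_eq_of_toBij_eq (f : Iso D L) (g : Iso D L')
    (h : (⟨L.toFrame, f.toBij⟩ : Σ Z : Frame, Bij D.toFrame Z) = ⟨L'.toFrame, g.toBij⟩)
    (τ : Episode D) : (⟨L, f.onEpisode τ⟩ : HashArg) = ⟨L', g.onEpisode τ⟩ := by
  obtain ⟨X, P, R, O, b, T⟩ := L
  obtain ⟨X', P', R', O', b', T'⟩ := L'
  obtain ⟨f, horizon, trans, obser, reward, init⟩ := f
  obtain ⟨g, horizon', trans', obser', reward', init'⟩ := g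
  dsimp only at horizon horizon'
  obtain ⟨rfl, h⟩ := Sigma.mk.inj h
  obtain rfl := eq_of_heq h
  subst horizon horizon'
  obtain rfl : P = P' := funext <| f.S.surjective.forall.2 fun s =>
    funext <| f.onA.surjective.forall.2 fun a =>
      PMF.ext <| f.S.surjective.forall.2 fun s' => (trans s a s').symm.trans (trans' s a s')
  obtain rfl : O = O' := funext <| f.S.surjective.forall.2 fun s =>
    funext <| f.onA.surjective.forall.2 fun a =>
      PMF.ext <| f.onO.surjective.forall.2 fun o => (obser s a o).symm.trans (obser' s a o)
  obtain rfl : R = R' := funext <| f.S.surjective.forall.2 fun s =>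
    funext <| f.onA.surjective.forall.2 fun a => (reward s a).symm.trans (reward' s a)
  obtain rfl : b = b' := PMF.ext <| f.S.surjective.forall.2 fun s =>
    (init s).symm.trans (init' s)
  rfl

lemma Labeling.hashArg_push (f : Iso D E) (g : Labeling D.toFrame) (τ : Episode D) :
    (⟨(g.push f.toBij).relabel E, (g.push f.toBij).onEpisode (f.onEpisode τ)⟩ : HashArg) =
      ⟨g.relabel D, g.onEpisode τ⟩ :=
  hashArg_eq_of_toBij_eq (f.comp ((g.push f.toBij).toIso E)) (g.toIso D)
    (g.comp_push_toBij f.toBij) τ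

end Numbered

section Invariance

variable {D E : DecPOMDP}

/-- The mean of the hash values over the labelings that put a history in normal form. -/
def meanHash (η : HashArg → ℝ) (τ : Episode D) : ℝ :=
  Finset.expect (normalLabelings τ) fun f => η ⟨f.relabel D, f.onEpisode τ⟩

lemma meanHash_onEpisode (η : HashArg → ℝ) (f : Iso D E) (τ : Episode D) :
    meanHash η (f.onEpisode τ) = meanHash η τ :=
  (Finset.expect_equiv (Equiv.ofBijective _ (Labeling.push_bijective f.toBij))
    (fun _ => (push_mem_normalLabelings f).symm)
    (fun g _ => congrArg η (g.hashArg_push f τ).symm)).symm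

lemma chi_congr (η : HashArg → ℝ) {π π' : Policy D} (h : symmetrizer π = symmetrizer π') :
    chi η D π = chi η D π' := by
  unfold chi
  rw [h]

lemma chi_pushPolicy (η : HashArg → ℝ) (f : Iso D E) (π : Policy D) :
    chi η E (pushPolicy f π) = chi η D π := by
  refine (Fintype.sum_equiv f.episodeEquiv _ _ fun τ => ?_).symm
  exact congrArg₂ _ (congrArg _ (prob_symmetrizer_onEpisode f π τ).symm)
    (meanHash_onEpisode η f τ).symm

lemma isIsoInvariant_chi (𝒟 : Set DecPOMDP) (η : HashArg → ℝ) : IsIsoInvariant 𝒟 (chi η) := by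
  intro D _ E _ f π π' h
  rw [← chi_pushPolicy η f π, chi_congr η (Quotient.exact h)]

end Invariance

section TotalProbability

variable {D : DecPOMDP}

lemma tsum_prod_pmf {ι : Type*} [Fintype ι] {A : ι → Type*} [∀ i, Finite (A i)]
    (p : ∀ i, PMF (A i)) : ∑' a : ∀ i, A i, ∏ i, p i (a i) = 1 := by
  classical
  let _ : ∀ i, Fintype (A i) := fun i => Fintype.ofFinite _
  rw [tsum_fintype, ← Fintype.prod_sum fun i a => p i a]
  exact Finset.prod_eq_one fun i _ => (tsum_fintype _).symm.trans (PMF.tsum_coe (p i))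

lemma tsum_pmf_mul {α β : Type*} (p : PMF α) {K : α → β → ℝ≥0∞} (hK : ∀ x, ∑' y, K x y = 1) :
    ∑' q : α × β, p q.1 * K q.1 q.2 = 1 := by
  rw [ENNReal.tsum_prod (f := fun x y => p x * K x y), ← p.tsum_coe]
  refine tsum_congr fun x => ?_
  rw [ENNReal.tsum_mul_left, hK, mul_one]

open Classical in
lemma tsum_act_rew (p : ∀ i, PMF (D.A i)) (x : D.S) :
    ∑' q : D.JointA × Set.range (fun q : D.S × D.JointA => D.R q.1 q.2),
      (∏ i, p i (q.1 i)) * (if (q.2 : ℝ) = D.R x q.1 then 1 else 0) = 1 := by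
  refine ENNReal.tsum_prod'.trans ((tsum_congr fun a => ?_).trans (tsum_prod_pmf p))
  dsimp only
  rw [ENNReal.tsum_mul_left, tsum_eq_single (D.rewardInRange x a)]
  · exact (congrArg _ (if_pos rfl)).trans (mul_one _)
  · exact fun r hr => if_neg fun h => hr (Subtype.ext h)

/-- Histories of length `0` as triples of a state, a joint action and a reward. -/
def History.zeroEquiv :
    History D 0 ≃ D.S × D.JointA × Set.range (fun q : D.S × D.JointA => D.R q.1 q.2) where
  toFun h := (h.state 0, h.act 0, h.rew 0)
  invFun q := ⟨fun _ => q.1, fun _ => q.2.1, fun _ => q.2.2, Fin.elim0⟩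
  left_inv h := by
    ext1 s
    · rw [Fin.fin_one_eq_zero s]
    · rw [Fin.fin_one_eq_zero s]
    · rw [Fin.fin_one_eq_zero s]
    · exact s.elim0
  right_inv _ := rfl

/-- The history up to the second to last time. -/
def History.init {t : ℕ} (h : History D (t + 1)) : History D t :=
  ⟨Fin.init h.state, Fin.init h.act, Fin.init h.rew, Fin.init h.obs⟩

/-- Histories of length `t + 1` as histories of length `t` extended by a state, a joint observation,
a joint action and a reward. -/
def History.succEquiv {t : ℕ} : History D (t + 1) ≃ History D t × D.S × D.JointO × D.JointA ×
    Set.range (fun q : D.S × D.JointA => D.R q.1 q.2) where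
  toFun h := (h.init, h.state (Fin.last _), h.obs (Fin.last _), h.act (Fin.last _),
    h.rew (Fin.last _))
  invFun q := ⟨Fin.snoc q.1.state q.2.1, Fin.snoc q.1.act q.2.2.2.1, Fin.snoc q.1.rew q.2.2.2.2,
    Fin.snoc q.1.obs q.2.2.1⟩
  left_inv h := by simp only [init, Fin.snoc_init_self]
  right_inv q := by simp only [init, Fin.init_snoc, Fin.snoc_last]

/-- The action-observation history of agent `i` after the history `h` and a further joint
observation `o`. -/
def History.aoSnoc {t : ℕ} (h : History D t) (o : D.JointO) (i : Fin D.N) :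
    Fin (t + 1) → D.A i × D.Ob i :=
  fun r => (h.act r i, (Fin.snoc (α := fun _ => D.JointO) h.obs o : Fin (t + 1) → D.JointO) r i)

lemma History.aoSnoc_init {t : ℕ} (h : History D (t + 1)) (i : Fin D.N) :
    h.init.aoSnoc (h.obs (Fin.last t)) i = h.ao i (t + 1) le_rfl := by
  unfold aoSnoc init
  rw [Fin.snoc_init_self]
  rfl

open Classical in
lemma prob_zero (π : Policy D) (ht : 0 ≤ D.T) (h : History D 0) :
    prob π ht h = D.b₀ (h.state 0) * ((∏ i, π i 0 ht Fin.elim0 (h.act 0 i)) *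
      if (h.rew 0 : ℝ) = D.R (h.state 0) (h.act 0) then 1 else 0) := by
  rw [prob, Fin.prod_univ_zero, mul_one, Fin.prod_univ_one]
  refine congrArg₂ _ rfl (congrArg₂ _ (Finset.prod_congr rfl fun i _ => ?_) rfl)
  exact congrArg (fun τ => π i 0 ht τ (h.act 0 i)) (Subsingleton.elim _ _)

open Classical in
lemma prob_succ (π : Policy D) {t : ℕ} (ht : t + 1 ≤ D.T) (h : History D (t + 1)) :
    prob π ht h = prob π (Nat.le_of_succ_le ht) h.init *
      (D.P (h.init.state (Fin.last t)) (h.init.act (Fin.last t)) (h.state (Fin.last _)) *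
      (D.O (h.state (Fin.last _)) (h.init.act (Fin.last t)) (h.obs (Fin.last t)) *
      ((∏ i, π i (t + 1) ht (h.init.aoSnoc (h.obs (Fin.last t)) i) (h.act (Fin.last _) i)) *
        if (h.rew (Fin.last _) : ℝ) = D.R (h.state (Fin.last _)) (h.act (Fin.last _))
          then 1 else 0))) := by
  have regroup : ∀ x y z u v w : ℝ≥0∞,
      x * (y * (z * u)) * (v * w) = x * y * v * (z * (u * w)) := fun x y z u v w => by ring
  simp only [History.aoSnoc_init]
  exact (congrArg₂ _ (congrArg₂ _ rfl (Fin.prod_univ_castSucc _))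
    (Fin.prod_univ_castSucc _)).trans (regroup _ _ _ _ _ _)

lemma sum_prob (π : Policy D) {t : ℕ} (ht : t ≤ D.T) : ∑ h : History D t, prob π ht h = 1 := by
  classical
  rw [← tsum_fintype (L := .unconditional _)]
  induction t with
  | zero =>
    simp only [prob_zero]
    exact (History.zeroEquiv.tsum_eq fun q => D.b₀ q.1 * ((∏ i, π i 0 ht Fin.elim0 (q.2.1 i)) *
      if (q.2.2 : ℝ) = D.R q.1 q.2.1 then 1 else 0)).trans
        (tsum_pmf_mul D.b₀ fun x => tsum_act_rew (fun i => π i 0 ht Fin.elim0) x)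
  | succ t ih =>
    simp only [prob_succ]
    refine (History.succEquiv.tsum_eq fun q => prob π (Nat.le_of_succ_le ht) q.1 *
      (D.P (q.1.state (Fin.last t)) (q.1.act (Fin.last t)) q.2.1 *
      (D.O q.2.1 (q.1.act (Fin.last t)) q.2.2.1 *
      ((∏ i, π i (t + 1) ht (q.1.aoSnoc q.2.2.1 i) (q.2.2.2.1 i)) *
        if (q.2.2.2.2 : ℝ) = D.R q.2.1 q.2.2.2.1 then 1 else 0)))).trans ?_
    refine ENNReal.tsum_prod'.trans (Eq.trans (tsum_congr fun h => ?_) (ih (Nat.le_of_succ_le ht)))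
    dsimp only
    rw [ENNReal.tsum_mul_left]
    refine (congrArg _ ?_).trans (mul_one _)
    exact tsum_pmf_mul (D.P (h.state (Fin.last t)) (h.act (Fin.last t))) fun x =>
      tsum_pmf_mul (D.O x (h.act (Fin.last t))) fun o =>
        tsum_act_rew (fun i => π i (t + 1) ht (h.aoSnoc o i)) x

lemma sum_toReal_prob (π : Policy D) {t : ℕ} (ht : t ≤ D.T) :
    ∑ h : History D t, (prob π ht h).toReal = 1 := by
  rw [← ENNReal.toReal_sum fun h _ => ((prob_le_one π ht h).trans_lt ENNReal.one_lt_top).ne,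
    sum_prob, ENNReal.toReal_one]

lemma chi_mem_Icc {η : HashArg → ℝ} {a b : ℝ}
    (hη : ∀ (f : Labeling D.toFrame) (τ : Episode (f.relabel D)), η ⟨f.relabel D, τ⟩ ∈ Set.Icc a b)
    (π : Policy D) : chi η D π ∈ Set.Icc a b := by
  have meanHash_mem : ∀ τ : Episode D, meanHash η τ ∈ Set.Icc a b := fun τ =>
    ⟨Finset.le_expect (normalLabelings_nonempty τ) fun f _ => (hη f _).1,
      Finset.expect_le (normalLabelings_nonempty τ) fun f _ => (hη f _).2⟩
  exact (convex_Icc a b).sum_mem (fun _ _ => ENNReal.toReal_nonneg)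
    (sum_toReal_prob (symmetrizer π) le_rfl) fun τ _ => meanHash_mem τ

end TotalProbability

section Separation

section Independence

variable {Ω : Type*} [MeasurableSpace Ω] {μ : Measure Ω}

lemma ae_ne_of_indepFun {β : Type*} [MeasurableSpace β] [MeasurableEq β]
    [MeasurableSingletonClass β] [IsFiniteMeasure μ] {X Y : Ω → β} (hX : Measurable X)
    (hY : Measurable Y) (hXY : IndepFun X Y μ) (hatoms : ∀ c, μ {ω | X ω = c} = 0) :
    ∀ᵐ ω ∂μ, X ω ≠ Y ω := by
  have diagonal_null : μ.map (fun ω => (Y ω, X ω)) (Set.diagonal β) = 0 := by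
    rw [(indepFun_iff_map_prod_eq_prod_map_map hY.aemeasurable hX.aemeasurable).1 hXY.symm]
    refine Measure.measure_prod_null_of_ae_null measurableSet_diagonal
      (Filter.Eventually.of_forall fun y => ?_)
    have slice_eq : Prod.mk y ⁻¹' Set.diagonal β = {y} := Set.ext fun x => eq_comm
    exact (congrArg _ slice_eq).trans
      ((Measure.map_apply hX (measurableSet_singleton y)).trans (hatoms y))
  rw [Measure.map_apply (hY.prodMk hX) measurableSet_diagonal] at diagonal_null
  exact (measure_eq_zero_iff_ae_notMem.1 diagonal_null).mono fun ω hω h => hω h.symm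

lemma ae_sum_mul_ne_zero {ι : Type*} {X : ι → Ω → ℝ} (hX : ∀ i, Measurable (X i))
    (hindep : iIndepFun X μ) (hatoms : ∀ i c, μ {ω | X i ω = c} = 0) {s : Finset ι} {c : ι → ℝ}
    {i : ι} (hi : i ∈ s) (hc : c i ≠ 0) : ∀ᵐ ω ∂μ, ∑ j ∈ s, c j * X j ω ≠ 0 := by
  classical
  have := hindep.isProbabilityMeasure
  have measurable_mul : ∀ j, Measurable fun ω => c j * X j ω := fun j => (hX j).const_mul (c j)
  have iIndepFun_mul : iIndepFun (fun j ω => c j * X j ω) μ :=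
    hindep.comp (fun j x => c j * x) fun j => measurable_const_mul (c j)
  have indepFun_rest : IndepFun (fun ω => c i * X i ω) (-∑ j ∈ s.erase i, fun ω => c j * X j ω) μ :=
    (iIndepFun_mul.indepFun_finsetSum_of_notMem measurable_mul
      (Finset.notMem_erase i s)).symm.comp measurable_id measurable_neg
  have measurable_rest : Measurable (-∑ j ∈ s.erase i, fun ω => c j * X j ω) :=
    .neg (by fun_prop)
  have noAtoms_mul : ∀ d, μ {ω | c i * X i ω = d} = 0 := fun d => by
    simpa only [eq_div_iff hc, mul_comm] using hatoms i (d / c i)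
  filter_upwards [ae_ne_of_indepFun (measurable_mul i) measurable_rest indepFun_rest noAtoms_mul]
    with ω hω h
  rw [← Finset.add_sum_erase _ _ hi] at h
  rw [Pi.neg_apply, Finset.sum_apply] at hω
  exact hω (eq_neg_of_add_eq_zero_left h)

lemma ae_sum_mul_comp_ne_zero {ι κ : Type*} {X : ι → Ω → ℝ} (hX : ∀ i, Measurable (X i))
    (hindep : iIndepFun X μ) (hatoms : ∀ i c, μ {ω | X i ω = c} = 0) {s : Finset κ} {c : κ → ℝ}
    {φ : κ → ι} {k : κ} (hk : k ∈ s) (hc : c k ≠ 0) (hφ : ∀ l ∈ s, φ l = φ k → c l = c k) :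
    ∀ᵐ ω ∂μ, ∑ l ∈ s, c l * X (φ l) ω ≠ 0 := by
  classical
  have coeff_ne_zero : ∑ l ∈ s with φ l = φ k, c l ≠ 0 := by
    rw [Finset.sum_congr rfl fun l hl => hφ l (Finset.mem_filter.1 hl).1 (Finset.mem_filter.1 hl).2,
      Finset.sum_const]
    exact smul_ne_zero (Finset.card_ne_zero_of_mem (Finset.mem_filter.2 ⟨hk, rfl⟩)) hc
  filter_upwards [ae_sum_mul_ne_zero hX hindep hatoms (c := fun i => ∑ l ∈ s with φ l = i, c l)
    (Finset.mem_image_of_mem φ hk) coeff_ne_zero] with ω hω h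
  refine hω (Eq.trans (Finset.sum_congr rfl fun i _ => ?_)
    ((Finset.sum_fiberwise_of_maps_to (fun l => Finset.mem_image_of_mem φ) _).trans h))
  rw [Finset.sum_mul]
  exact Finset.sum_congr rfl fun l hl => by rw [(Finset.mem_filter.1 hl).2]

end Independence

variable {D E L L' : DecPOMDP}

lemma card_normalLabelings_onEpisode (f : Iso D E) (τ : Episode D) :
    (normalLabelings (f.onEpisode τ)).card = (normalLabelings τ).card :=
  (Finset.card_equiv (Equiv.ofBijective _ (Labeling.push_bijective f.toBij)) fun _ =>
    (push_mem_normalLabelings f).symm).symm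

lemma card_normalLabelings_eq_of_onEpisode_eq (f : Iso D L) (g : Iso D L') {τ τ' : Episode D}
    (h : (⟨L, f.onEpisode τ⟩ : HashArg) = ⟨L', g.onEpisode τ'⟩) :
    (normalLabelings τ).card = (normalLabelings τ').card := by
  obtain ⟨rfl, h⟩ := Sigma.mk.inj h
  rw [← card_normalLabelings_onEpisode f, eq_of_heq h, card_normalLabelings_onEpisode]

/-- The coefficient of the hash value at `f τ`, for each `f ∈ 𝒦(τ)`, in the difference of the values
of `χ^#` at two policies. -/
def diffCoeff (π π' : Policy D) (τ : Episode D) : ℝ :=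
  ((prob (symmetrizer π) le_rfl τ).toReal - (prob (symmetrizer π') le_rfl τ).toReal) /
    (normalLabelings τ).card

lemma diffCoeff_eq_of_onEpisode_eq (f : Iso D L) (g : Iso D L') (π π' : Policy D)
    {τ τ' : Episode D} (h : (⟨L, f.onEpisode τ⟩ : HashArg) = ⟨L', g.onEpisode τ'⟩) :
    diffCoeff π π' τ = diffCoeff π π' τ' := by
  rw [diffCoeff, prob_symmetrizer_eq_of_onEpisode_eq f g π h,
    prob_symmetrizer_eq_of_onEpisode_eq f g π' h, card_normalLabelings_eq_of_onEpisode_eq f g h,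
    diffCoeff]

lemma diffCoeff_ne_zero {π π' : Policy D} {τ : Episode D}
    (h : prob (symmetrizer π) le_rfl τ ≠ prob (symmetrizer π') le_rfl τ) :
    diffCoeff π π' τ ≠ 0 := by
  have prob_ne_top : ∀ σ : Policy D, prob σ le_rfl τ ≠ ⊤ := fun σ =>
    ((prob_le_one σ le_rfl τ).trans_lt ENNReal.one_lt_top).ne
  refine div_ne_zero (sub_ne_zero.2 fun h' => h ?_)
    (Nat.cast_ne_zero.2 (normalLabelings_nonempty τ).card_ne_zero)
  exact (ENNReal.toReal_eq_toReal_iff' (prob_ne_top _) (prob_ne_top _)).1 h'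

lemma chi_sub_chi (η : HashArg → ℝ) (π π' : Policy D) :
    chi η D π - chi η D π' = ∑ q ∈ Finset.univ.sigma fun τ : Episode D => normalLabelings τ,
      diffCoeff π π' q.1 * η ⟨q.2.relabel D, q.2.onEpisode q.1⟩ := by
  unfold chi
  rw [← Finset.sum_sub_distrib, Finset.sum_sigma]
  refine Finset.sum_congr rfl fun τ _ => ?_
  refine Eq.trans ?_ (Finset.mul_sum (normalLabelings τ)
    (fun f => η ⟨f.relabel D, f.onEpisode τ⟩) (diffCoeff π π' τ))
  rw [← sub_mul, Finset.expect_eq_sum_div_card, diffCoeff, mul_div_assoc',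
    div_mul_eq_mul_div]

lemma ae_chi_ne {𝒟 : Set DecPOMDP} {Ω : Type*} [MeasurableSpace Ω] {μ : Measure Ω}
    {hash : HashArg → Ω → ℝ} (hmeas : ∀ x ∈ hashArgs 𝒟, Measurable (hash x))
    (hindep : iIndepFun (fun x : hashArgs 𝒟 => hash x) μ)
    (hatoms : ∀ x ∈ hashArgs 𝒟, ∀ c, μ {ω | hash x ω = c} = 0)
    (hD : D ∈ 𝒟) (hdet : HistoriesDetermine D) {π π' : Policy D} (hne : ¬ policySetoid D π π') :
    ∀ᵐ ω ∂μ, chi (fun x => hash x ω) D π ≠ chi (fun x => hash x ω) D π' := by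
  obtain ⟨τ, hτ⟩ : ∃ τ : Episode D,
      prob (symmetrizer π) le_rfl τ ≠ prob (symmetrizer π') le_rfl τ := by
    by_contra! h
    exact hne (hdet π π' h)
  obtain ⟨f, hf⟩ := normalLabelings_nonempty τ
  filter_upwards [ae_sum_mul_comp_ne_zero (fun x : hashArgs 𝒟 => hmeas x x.2) hindep
    (fun x => hatoms x x.2) (s := Finset.univ.sigma fun τ : Episode D => normalLabelings τ)
    (c := fun q => diffCoeff π π' q.1) (k := ⟨τ, f⟩)
    (φ := fun q => ⟨⟨q.2.relabel D, q.2.onEpisode q.1⟩, D, hD, q.2, rfl⟩)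
    (Finset.mem_sigma.2 ⟨Finset.mem_univ _, hf⟩) (diffCoeff_ne_zero hτ)
    fun q _ h => diffCoeff_eq_of_onEpisode_eq (q.2.toIso D) (f.toIso D) π π'
      (congrArg Subtype.val h)] with ω hω h
  exact hω ((chi_sub_chi (fun x => hash x ω) π π').symm.trans (sub_eq_zero.2 h))

end Separation

section Optimal

variable {D E : DecPOMDP} {i : Fin D.N}

/-- The distribution whose weights are the coordinates of a point of the standard simplex. -/
def simplexPMF {α : Type*} [Fintype α] (x : stdSimplex ℝ α) : PMF α :=
  PMF.ofFintype (fun a => ENNReal.ofReal (x a)) <| by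
    rw [← ENNReal.ofReal_sum_of_nonneg fun a _ => stdSimplex.zero_le x a, stdSimplex.sum_eq_one,
      ENNReal.ofReal_one]

lemma toReal_simplexPMF {α : Type*} [Fintype α] (x : stdSimplex ℝ α) (a : α) :
    (simplexPMF x a).toReal = x a :=
  ENNReal.toReal_ofReal (stdSimplex.zero_le x a)

lemma simplexPMF_surjective {α : Type*} [Fintype α] :
    Function.Surjective (simplexPMF : stdSimplex ℝ α → PMF α) := fun p => by
  refine ⟨⟨fun a => (p a).toReal, fun a => ENNReal.toReal_nonneg, ?_⟩, ?_⟩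
  · rw [← ENNReal.toReal_sum fun a _ => p.apply_ne_top a, ← tsum_fintype (L := .unconditional _),
      p.tsum_coe, ENNReal.toReal_one]
  · exact PMF.ext fun a => ENNReal.ofReal_toReal (p.apply_ne_top a)

/-- The topology of pointwise convergence of the action probabilities. -/
instance : TopologicalSpace (LocalPolicy D i) :=
  ⨅ (t : ℕ) (ht : t ≤ D.T) (τ : Fin t → D.A i × D.Ob i) (a : D.A i),
    .induced (fun p : LocalPolicy D i => (p t ht τ a).toReal) inferInstance

lemma continuous_localPolicy_apply {t : ℕ} (ht : t ≤ D.T) (τ : Fin t → D.A i × D.Ob i)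
    (a : D.A i) : Continuous fun p : LocalPolicy D i => (p t ht τ a).toReal :=
  continuous_iInf_dom <| continuous_iInf_dom <| continuous_iInf_dom <| continuous_iInf_dom
    continuous_induced_dom

lemma continuous_localPolicy {Z : Type*} [TopologicalSpace Z] {p : Z → LocalPolicy D i}
    (hp : ∀ t (ht : t ≤ D.T) τ a, Continuous fun z => (p z t ht τ a).toReal) : Continuous p := by
  simp only [continuous_iInf_rng, continuous_induced_rng]
  exact hp

/-- The local policy that draws its actions from given points of the standard simplex. -/
def simplexPolicy [Fintype (D.A i)]
    (x : ∀ t : Fin (D.T + 1), (Fin t → D.A i × D.Ob i) → stdSimplex ℝ (D.A i)) : LocalPolicy D i :=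
  fun t ht τ => simplexPMF (x ⟨t, Nat.lt_succ_of_le ht⟩ τ)

lemma continuous_simplexPolicy [Fintype (D.A i)] :
    Continuous (simplexPolicy (D := D) (i := i)) :=
  continuous_localPolicy fun t ht τ a => by
    simp only [simplexPolicy, toReal_simplexPMF]
    exact (continuous_apply a).comp (continuous_subtype_val.comp
      ((continuous_apply τ).comp (continuous_apply _)))

lemma simplexPolicy_surjective [Fintype (D.A i)] :
    Function.Surjective (simplexPolicy (D := D) (i := i)) := fun p =>
  ⟨fun t τ => Function.surjInv simplexPMF_surjective (p t (Nat.le_of_lt_succ t.2) τ),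
    funext fun _ => funext fun _ => funext fun _ =>
      Function.surjInv_eq simplexPMF_surjective _⟩

instance : CompactSpace (LocalPolicy D i) :=
  let _ := Fintype.ofFinite (D.A i)
  simplexPolicy_surjective.compactSpace continuous_simplexPolicy

lemma continuous_policy_apply {t : ℕ} (ht : t ≤ D.T) (τ : Fin t → D.A i × D.Ob i) (a : D.A i) :
    Continuous fun π : Policy D => (π i t ht τ a).toReal :=
  (continuous_localPolicy_apply ht τ a).comp (continuous_apply i)

lemma continuous_pushLocal (f : Iso D E) (j : Fin E.N) : Continuous (pushLocal f j) := by
  refine continuous_localPolicy fun t ht τ a => ?_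
  obtain ⟨τ, rfl⟩ := (f.onAO j).surjective.comp_left τ
  obtain ⟨a, rfl⟩ := (f.A j).surjective a
  simp only [pushLocal_apply f j _ (ht.trans_eq f.horizon.symm)]
  exact continuous_localPolicy_apply _ τ a

lemma continuous_pushProfile (g : Fin D.N → Aut D) : Continuous (pushProfile g) :=
  continuous_pi fun i => (continuous_pushLocal (g i) i).comp (continuous_apply _)

lemma continuous_prob {t : ℕ} (ht : t ≤ D.T) (h : History D t) :
    Continuous fun π : Policy D => (prob π ht h).toReal := by
  simp only [prob_eq_envProb_mul, pathWeight, ENNReal.toReal_mul, ENNReal.toReal_prod]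
  exact continuous_const.mul (continuous_finsetProd _ fun i _ =>
    (continuous_finsetProd _ fun s _ => continuous_policy_apply _ _ _).mul
      (continuous_policy_apply _ _ _))

lemma continuous_selfPlay : Continuous (selfPlay (D := D)) :=
  continuous_finsetSum _ fun h _ => (continuous_prob le_rfl h).mul continuous_const

lemma continuous_otherPlay : Continuous (otherPlay (D := D)) := by
  unfold otherPlay
  simp only [Finset.expect_eq_sum_div_card]
  exact (continuous_finsetSum _ fun g _ =>
    continuous_selfPlay.comp (continuous_pushProfile g)).div_const _

lemma opOptimal_nonempty (D : DecPOMDP) : (opOptimal D).Nonempty := by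
  obtain ⟨π, -, hπ⟩ := isCompact_univ.exists_isMaxOn (Set.nonempty_of_mem (Set.mem_univ
    (uniformLocal D))) continuous_otherPlay.continuousOn
  exact ⟨π, fun π' => hπ (Set.mem_univ π')⟩

end Optimal

section TieBreaking

variable {D : DecPOMDP}

/-- The restriction of `≡` to the other-play optimal policies. -/
abbrev opSetoid (D : DecPOMDP) : Setoid (opOptimal D) :=
  (policySetoid D).comap (↑)

lemma chi_out_mk (η : HashArg → ℝ) (π : opOptimal D) :
    chi η D (Quotient.mk (opSetoid D) π).out = chi η D π :=
  chi_congr η (Quotient.mk_out (s := opSetoid D) π)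

lemma exists_isMax_chi (hfin : FiniteOPClasses D) (η : HashArg → ℝ) :
    ∃ π ∈ opOptimal D, ∀ π' ∈ opOptimal D, chi η D π' ≤ chi η D π := by
  have : Finite (Quotient (opSetoid D)) := hfin
  have : Nonempty (Quotient (opSetoid D)) :=
    (opOptimal_nonempty D).to_subtype.map (Quotient.mk _)
  obtain ⟨x, hx⟩ := Finite.exists_max fun x : Quotient (opSetoid D) => chi η D x.out
  exact ⟨x.out, x.out.2, fun π' h' => (chi_out_mk η ⟨π', h'⟩).symm.trans_le (hx _)⟩

section

variable {𝒟 : Set DecPOMDP} {Ω : Type*} [MeasurableSpace Ω] {μ : Measure Ω}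
  {hash : HashArg → Ω → ℝ}

lemma ae_injective_chi_out (hmeas : ∀ x ∈ hashArgs 𝒟, Measurable (hash x))
    (hindep : iIndepFun (fun x : hashArgs 𝒟 => hash x) μ)
    (hatoms : ∀ x ∈ hashArgs 𝒟, ∀ c, μ {ω | hash x ω = c} = 0)
    (hD : D ∈ 𝒟) (hfin : FiniteOPClasses D) (hdet : HistoriesDetermine D) :
    ∀ᵐ ω ∂μ, Function.Injective fun x : Quotient (opSetoid D) =>
      chi (fun x => hash x ω) D x.out := by
  have : Finite (Quotient (opSetoid D)) := hfin
  have separated : ∀ x y : Quotient (opSetoid D), x ≠ y →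
      ∀ᵐ ω ∂μ, chi (fun x => hash x ω) D x.out ≠ chi (fun x => hash x ω) D y.out :=
    fun x y hxy => ae_chi_ne hmeas hindep hatoms hD hdet fun h => hxy (Quotient.out_equiv_out.1 h)
  filter_upwards [ae_all_iff.2 fun x => ae_all_iff.2 fun y => Filter.eventually_imp_distrib_left.2
    (separated x y)] with ω hω x y
  exact not_imp_not.1 (hω x y)

lemma ae_isTieBreaking_chi (hmeas : ∀ x ∈ hashArgs 𝒟, Measurable (hash x))
    (hindep : iIndepFun (fun x : hashArgs 𝒟 => hash x) μ)
    (hatoms : ∀ x ∈ hashArgs 𝒟, ∀ c, μ {ω | hash x ω = c} = 0)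
    {𝒞 : Set DecPOMDP} (h𝒞 : 𝒞 ⊆ 𝒟) (hcount : 𝒞.Countable)
    (hfin : ∀ D ∈ 𝒞, FiniteOPClasses D) (hdet : ∀ D ∈ 𝒞, HistoriesDetermine D) :
    ∀ᵐ ω ∂μ, IsTieBreaking 𝒞 (chi fun x => hash x ω) := by
  refine (ae_ball_iff hcount).2 fun D hD => ?_
  filter_upwards [ae_injective_chi_out hmeas hindep hatoms (h𝒞 hD) (hfin D hD) (hdet D hD)]
    with ω hω
  refine ⟨exists_isMax_chi (hfin D hD) _, fun π hπ π' hπ' h => ?_⟩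
  have mk_eq : Quotient.mk (opSetoid D) ⟨π, hπ⟩ = Quotient.mk (opSetoid D) ⟨π', hπ'⟩ :=
    hω (by simpa only [chi_out_mk] using h)
  exact (Setoid.comap_rel _ _ _ _).1 (Quotient.eq.1 mk_eq)

end

end TieBreaking

end LFC

end

theorem mainTheorem7_general (𝒟 : Set LFC.DecPOMDP) {Ω : Type*} [MeasurableSpace Ω]
    {μ : MeasureTheory.Measure Ω} {hash : LFC.HashArg → Ω → ℝ}
    (hmeas : ∀ x ∈ LFC.hashArgs 𝒟, Measurable (hash x))
    (hindep : ProbabilityTheory.iIndepFun (fun x : LFC.hashArgs 𝒟 => hash x) μ)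
    (hatoms : ∀ x ∈ LFC.hashArgs 𝒟, ∀ c, μ {ω | hash x ω = c} = 0) :
    (∀ ω, LFC.IsIsoInvariant 𝒟 (LFC.chi fun x => hash x ω)) ∧
    (∀ ω a b, (∀ x ∈ LFC.hashArgs 𝒟, hash x ω ∈ Set.Icc a b) →
      ∀ D ∈ 𝒟, ∀ π : LFC.Policy D, LFC.chi (fun x => hash x ω) D π ∈ Set.Icc a b) ∧
    (∀ D ∈ 𝒟, LFC.HistoriesDetermine D → ∀ π π' : LFC.Policy D, ¬ LFC.policySetoid D π π' →
      ∀ᵐ ω ∂μ, LFC.chi (fun x => hash x ω) D π ≠ LFC.chi (fun x => hash x ω) D π') ∧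
    (∀ 𝒞 ⊆ 𝒟, 𝒞.Countable → (∀ D ∈ 𝒞, LFC.FiniteOPClasses D) →
      (∀ D ∈ 𝒞, LFC.HistoriesDetermine D) →
        ∀ᵐ ω ∂μ, LFC.IsTieBreaking 𝒞 (LFC.chi fun x => hash x ω)) :=
  ⟨fun _ => LFC.isIsoInvariant_chi 𝒟 _,
    fun _ _ _ hη D hD => LFC.chi_mem_Icc fun f _ => hη _ ⟨D, hD, f, rfl⟩,
    fun _ hD hdet _ _ => LFC.ae_chi_ne hmeas hindep hatoms hD hdet,
    fun _ => LFC.ae_isTieBreaking_chi hmeas hindep hatoms⟩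

theorem mainTheorem7 (𝒟 : Set LFC.DecPOMDP) {Ω : Type*} [MeasurableSpace Ω]
    (μ : MeasureTheory.Measure Ω) [MeasureTheory.IsProbabilityMeasure μ]
    (hash : LFC.HashArg → Ω → ℝ) (hhash : LFC.IsRandomHash 𝒟 μ hash) :
    -- for every realization, `χ^#` is invariant to isomorphism
    (∀ ω, LFC.IsIsoInvariant 𝒟 (LFC.chi fun x => hash x ω)) ∧
    -- and it has values in `[0, 1]` if the hash values do
    (∀ ω, (∀ x ∈ LFC.hashArgs 𝒟, hash x ω ∈ Set.Icc (0 : ℝ) 1) →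
      ∀ D ∈ 𝒟, ∀ π : LFC.Policy D, LFC.chi (fun x => hash x ω) D π ∈ Set.Icc (0 : ℝ) 1) ∧
    -- any two given non-equivalent policies, optimal or not, are almost surely separated
    ((∀ D ∈ 𝒟, LFC.HistoriesDetermine D) →
      ∀ D ∈ 𝒟, ∀ π π' : LFC.Policy D, ¬ LFC.policySetoid D π π' →
        ∀ᵐ ω ∂μ, LFC.chi (fun x => hash x ω) D π ≠ LFC.chi (fun x => hash x ω) D π') ∧
    -- `χ^#` is almost surely a tie-breaking function
    ((∀ D ∈ 𝒟, LFC.FiniteOPClasses D) → (∀ D ∈ 𝒟, LFC.HistoriesDetermine D) →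
      ∀ 𝒞 ⊆ 𝒟, 𝒞.Countable → ∀ᵐ ω ∂μ, LFC.IsTieBreaking 𝒞 (LFC.chi fun x => hash x ω)) :=
  have ⟨invariant, range, separates, tieBreaking⟩ :=
    mainTheorem7_general 𝒟 hhash.measurable hhash.indep hhash.noAtoms
  ⟨invariant, fun ω => range ω 0 1, fun hdet D hD => separates D hD (hdet D hD),
    fun hfin hdet 𝒞 h𝒞 hcount => tieBreaking 𝒞 h𝒞 hcount (fun D hD => hfin D (h𝒞 hD))
      fun D hD => hdet D (h𝒞 hD)⟩
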